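/- For a real number $c\neq 0$ and $r\ge 1$ let $$\tilde{\mathfrak H}_r(t_1,\dots,t_r;c)=\prod_{j=1}^{r}\left(\frac{1}{e^{t_j+\cdots+t_r}-1}-\frac{c}{e^{c(t_j+\cdots+t_r)}-1}\right),$$ where the removable singularities of the factors at $t_j+\cdots+t_r=0$ are filled in. Let $\mathcal C$ be the Hankel contour of sufficiently small radius $\varepsilon>0$: it comes from $+\infty$ to $\varepsilon$ along the top side of the positive real axis, runs once counterclockwise around the circle $|t|=\varepsilon$, and returns to $+\infty$ along the bottom side of the positive real axis; along $\mathcal C$ the argument of $t$ in $t^{s-1}$ increases from $0$ to $2\pi$. The desingularized multiple zeta function is defined for $s_1,\dots,s_r\in\mathbb C\setminus\mathbb Z$ by $$\zeta^{\rm des}_r(s_1,\dots,s_r)=\lim_{c\to1,\,c\ne1}\frac{1}{(1-c)^r}\prod_{k=1}^{r}\frac{1}{(e^{2\pi i s_k}-1)\Gamma(s_k)}\int_{\mathcal C^r}\tilde{\mathfrak H}_r(t_1,\dots,t_r;c)\prod_{k=1}^{r}t_k^{s_k-1}\,dt_k,$$ and at the other points of $\mathbb C^r$ by analytic continuation. Proposition.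 Let $n,m$ be positive integers. Then $\zeta^{\rm des}_1$ continues holomorphically to neighbourhoods of $n$ and of $m$, $\zeta^{\rm des}_2$ continues holomorphically to a neighbourhood of $(n+m-j,j)$ for every $1\le j\le n+m-1$, and the values of the continuations satisfy $$\zeta^{\rm des}_1(n)\,\zeta^{\rm des}_1(m)=\sum_{j=1}^{n+m-1}\left\{\binom{j-1}{n-1}+\binom{j-1}{m-1}\right\}\zeta^{\rm des}_2(n+m-j,j),$$ where $\binom{k}{i}=0$ for $k<i$. -/

import Mathlib

open Filter Topology

noncomputable section

namespace DesMZF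

/-- The one-variable factor `1/(e^x - 1) - c/(e^{cx} - 1) = ∑_{m ≥ 1} (1 - c^m) B_m x^{m-1}/m!`.
At `x = 0`, a removable singularity, it has the value `(1 - c) B_1 = (c - 1)/2` of the series. -/
def kernelFactor (c : ℝ) (x : ℂ) : ℂ :=
  if x = 0 then ((c : ℂ) - 1) / 2
  else 1 / (Complex.exp x - 1) - (c : ℂ) / (Complex.exp ((c : ℂ) * x) - 1)

/-- The generating function `∏_j (1/(e^{t_j+⋯+t_r} - 1) - c/(e^{c(t_j+⋯+t_r)} - 1))`. -/
def kernel (r : ℕ) (c : ℝ) (t : Fin r → ℂ) : ℂ :=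
  ∏ j : Fin r, kernelFactor c (∑ k ∈ Finset.Ici j, t k)

/-! The Hankel contour of radius `ε`, parametrized by `u ∈ ℝ`: for `u ≤ 0` it comes in from `+∞`
to `ε` along the top side of the positive real axis (argument `0`), for `0 ≤ u ≤ 2π` it runs once
counterclockwise around the circle of radius `ε`, and for `u ≥ 2π` it goes back from `ε` to `+∞`
along the bottom side of the axis (argument `2π`). -/

/-- The modulus of the point of the Hankel contour with parameter `u`. -/
def hankelRadius (ε u : ℝ) : ℝ :=
  if u < 0 then ε - u else if u ≤ 2 * Real.pi then ε else ε + (u - 2 * Real.pi)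

/-- The continuously chosen argument, from `0` to `2π`, along the Hankel contour. -/
def hankelArg (u : ℝ) : ℝ :=
  if u < 0 then 0 else if u ≤ 2 * Real.pi then u else 2 * Real.pi

/-- The continuous branch of `log t` along the Hankel contour. -/
def hankelLog (ε u : ℝ) : ℂ :=
  (Real.log (hankelRadius ε u) : ℂ) + (hankelArg u : ℂ) * Complex.I

/-- The point `t` of the Hankel contour with parameter `u`. -/
def hankelPoint (ε u : ℝ) : ℂ :=
  (hankelRadius ε u : ℂ) * Complex.exp ((hankelArg u : ℂ) * Complex.I)

/-- The velocity `dt/du` along the Hankel contour. -/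
def hankelVelocity (ε u : ℝ) : ℂ :=
  if u < 0 then -1
  else if u ≤ 2 * Real.pi then Complex.I * (ε : ℂ) * Complex.exp ((u : ℂ) * Complex.I)
  else 1

/-- The `r`-fold contour integral `∫_{C^r} f(t_1,…,t_r) ∏_k t_k^{s_k - 1} dt_k` over the `r`-th
power of the Hankel contour `C` of radius `ε`. -/
def hankelIntegral (r : ℕ) (ε : ℝ) (f : (Fin r → ℂ) → ℂ) (s : Fin r → ℂ) : ℂ :=
  ∫ u : Fin r → ℝ, f (fun k => hankelPoint ε (u k)) *
    ∏ k, (Complex.exp ((s k - 1) * hankelLog ε (u k)) * hankelVelocity ε (u k))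

/-- `C(s) = ∏_k 1/((e^{2πi s_k} - 1) Γ(s_k))`. -/
def hankelCoeff (r : ℕ) (s : Fin r → ℂ) : ℂ :=
  ∏ k, 1 / ((Complex.exp (2 * Real.pi * Complex.I * s k) - 1) * Complex.Gamma (s k))

/-- The set `(ℂ ∖ ℤ)^r`. -/
def nonint (r : ℕ) : Set (Fin r → ℂ) :=
  {s | ∀ k, s k ∉ Set.range ((↑) : ℤ → ℂ)}

/-- For `s ∈ (ℂ ∖ ℤ)^r`: the defining formula
`v = lim_{c → 1, c ≠ 1} (1 - c)^{-r} C(s) ∫_{C^r} kernel(t; c) ∏ t_k^{s_k - 1} dt_k`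
holds, for every Hankel contour `C` of sufficiently small radius. -/
def IsDesZetaLimit (r : ℕ) (s : Fin r → ℂ) (v : ℂ) : Prop :=
  ∀ᶠ ε : ℝ in 𝓝[>] 0,
    Tendsto
      (fun c : ℝ => 1 / (1 - (c : ℂ)) ^ r * hankelCoeff r s * hankelIntegral r ε (kernel r c) s)
      (𝓝[≠] 1) (𝓝 v)

/-- `v` is the value at `s ∈ ℂ^r` of the analytic continuation of the function defined on
`(ℂ ∖ ℤ)^r` by `IsDesZetaLimit`: a holomorphic function `F` on an open neighbourhood `U` of `s`
coincides with that function on `U ∩ (ℂ ∖ ℤ)^r`, and `F s = v`. -/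
def IsDesZetaValue (r : ℕ) (s : Fin r → ℂ) (v : ℂ) : Prop :=
  ∃ (U : Set (Fin r → ℂ)) (F : (Fin r → ℂ) → ℂ), IsOpen U ∧ s ∈ U ∧ DifferentiableOn ℂ F U ∧
    (∀ z ∈ U ∩ nonint r, IsDesZetaLimit r z (F z)) ∧ F s = v

theorem dense_nonint (r : ℕ) : Dense (nonint r) := by
  have h1 : Dense ((Set.range ((↑) : ℤ → ℂ))ᶜ) :=
    (Set.countable_range ((↑) : ℤ → ℂ)).dense_compl ℝ
  have h2 := dense_pi (Set.univ : Set (Fin r)) (fun _ _ => h1)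
  convert h2 using 1
  ext s
  simp [nonint]

theorem IsDesZetaLimit.unique {r : ℕ} {s : Fin r → ℂ} {v w : ℂ}
    (hv : IsDesZetaLimit r s v) (hw : IsDesZetaLimit r s w) : v = w := by
  obtain ⟨ε, h1, h2⟩ := (hv.and hw).exists
  exact tendsto_nhds_unique h1 h2

/-- The value of the analytic continuation at a point is unique. -/
theorem IsDesZetaValue.unique {r : ℕ} {s : Fin r → ℂ} {v w : ℂ}
    (hv : IsDesZetaValue r s v) (hw : IsDesZetaValue r s w) : v = w := by
  obtain ⟨U, F, hU, hsU, hF, hFl, rfl⟩ := hv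
  obtain ⟨V, G, hV, hsV, hG, hGl, rfl⟩ := hw
  have hne : (𝓝[nonint r] s).NeBot := mem_closure_iff_nhdsWithin_neBot.1 (dense_nonint r s)
  have hFc : Tendsto F (𝓝[nonint r] s) (𝓝 (F s)) :=
    ((hF.differentiableAt (hU.mem_nhds hsU)).continuousAt).tendsto.mono_left nhdsWithin_le_nhds
  have hGc : Tendsto G (𝓝[nonint r] s) (𝓝 (G s)) :=
    ((hG.differentiableAt (hV.mem_nhds hsV)).continuousAt).tendsto.mono_left nhdsWithin_le_nhds
  refine tendsto_nhds_unique hFc (hGc.congr' ?_)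
  filter_upwards [self_mem_nhdsWithin, nhdsWithin_le_nhds (hU.mem_nhds hsU),
    nhdsWithin_le_nhds (hV.mem_nhds hsV)] with z hz hzU hzV
  exact (hGl z ⟨hzV, hz⟩).unique (hFl z ⟨hzU, hz⟩)

open Classical in
/-- The desingularized multiple zeta function `ζ_r^des(s_1,…,s_r)`: the value at `s` of the
analytic continuation (and `0` where there is no continuation). -/
def desZeta (r : ℕ) (s : Fin r → ℂ) : ℂ :=
  if h : ∃ v, IsDesZetaValue r s v then h.choose else 0

end DesMZF

end

/-! Put B(x) = x/(e^x - 1) and φ = B' (`limitFactor`). Each factor of the kernel is (B(x) -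
B(cx))/x. Divided by 1 - c it is the slope of B between x and cx (`kernelFactor_div_of_ne`), so it
tends to φ(x) as c → 1. The mean value inequality gives an exponentially decaying bound uniform in c
(`exists_norm_kernelFactor_div_le`), and dominated convergence puts the limit inside the Hankel
integral.

The function φ is holomorphic near the closed positive axis, including 0, and decays exponentially.
For Re s_k > 0 the contour therefore collapses onto (0, ∞), one variable at a time, each variable
producing a factor e^{2πi s_k} - 1 (`integral_hankel_eq`, `integral_pi_contour_change`). This
cancels the normalization, and `isDesZetaLimit_mellinDes` gives ζ_r^des(s) = ∏ Γ(s_k)⁻¹ ∫_{(0,∞)^r}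
∏_j φ(x_j + ⋯ + x_r) ∏ x_k^{s_k - 1} dx_k. The right side is holomorphic on Re s_k > 0
(`differentiableAt_integral_limitKernel`), a region containing every point of the theorem, so it is
the continuation there (`desZeta_eq_mellinDes`).

The formula is now a shuffle product (`mellinDes_one_mul`). The product of two single integrals is
an integral of φ(u)φ(v)u^{n-1}v^{m-1} over the quadrant, which the diagonal cuts in two. On u > v
put u = x + y, v = y: then φ(x+y)φ(y) is the depth-two kernel, and the binomial expansion of
(x+y)^{n-1} yields double zeta values. The other half exchanges n and m. -/

noncomputable section

namespace DesMZF

open MeasureTheory Complex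

/-! ### The generating function of the Bernoulli numbers -/

/-- The meromorphic function `z / (e^z - 1)`, with the value `1` at `0`. -/
def bernoulliGen (z : ℂ) : ℂ := (dslope Complex.exp 0 z)⁻¹

/-- The derivative of `z / (e^z - 1)`, the limit of `kernelFactor c / (1 - c)` as `c → 1`. -/
def limitFactor (z : ℂ) : ℂ := deriv bernoulliGen z

/-- The half-strip `Re z > -δ`, `|Im z| < δ`. -/
def halfStrip (δ : ℝ) : Set ℂ := {z | -δ < z.re ∧ |z.im| < δ}

theorem isOpen_halfStrip (δ : ℝ) : IsOpen (halfStrip δ) :=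
  (isOpen_lt continuous_const continuous_re).inter (isOpen_lt continuous_im.abs continuous_const)

theorem halfStrip_mono {a b : ℝ} (h : a ≤ b) : halfStrip a ⊆ halfStrip b :=
  fun _ hz => ⟨by linarith [hz.1], by linarith [hz.2]⟩

theorem ofReal_mem_halfStrip {δ x : ℝ} (hδ : 0 < δ) (hx : 0 < x) : (x : ℂ) ∈ halfStrip δ := by
  simp only [halfStrip, Set.mem_ofPred_eq, ofReal_re, ofReal_im, abs_zero]
  exact ⟨by linarith, hδ⟩

theorem bernoulliGen_of_ne {z : ℂ} (hz : z ≠ 0) : bernoulliGen z = z / (Complex.exp z - 1) := by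
  rw [bernoulliGen, dslope_of_ne _ hz, slope_def_field, inv_div]; simp

theorem differentiable_dslope_exp : Differentiable ℂ (dslope Complex.exp 0) := by
  rw [← differentiableOn_univ, Complex.differentiableOn_dslope univ_mem]
  exact Complex.differentiable_exp.differentiableOn

/-- The nonzero solutions 2πin of e^z = 1 have |Im| ≥ 2π > 3. The width 3 leaves room for the two
later losses: a Cauchy estimate on unit discs (3 to 2) and multiplication by c ≤ 2 (2 to 1). -/
theorem exp_ne_one_of_abs_im_le {z : ℂ} (h0 : z ≠ 0) (hz : |z.im| ≤ 3) : Complex.exp z ≠ 1 := by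
  intro h
  obtain ⟨n, rfl⟩ := Complex.exp_eq_one_iff.1 h
  have hn : n ≠ 0 := by rintro rfl; simp at h0
  have h1 : (1 : ℝ) ≤ |(n : ℝ)| := by exact_mod_cast Int.one_le_abs hn
  have h2 : ((n : ℂ) * (2 * Real.pi * I)).im = n * (2 * Real.pi) := by simp
  rw [h2, abs_mul, abs_of_pos Real.two_pi_pos] at hz
  nlinarith [Real.pi_gt_three]

theorem dslope_exp_ne_zero {z : ℂ} (hz : |z.im| ≤ 3) : dslope Complex.exp 0 z ≠ 0 := by
  by_cases h0 : z = 0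
  · subst h0; simp
  · rw [dslope_of_ne _ h0, slope_def_field]
    have := exp_ne_one_of_abs_im_le h0 hz
    simp [h0, sub_eq_zero, this]

theorem differentiableAt_bernoulliGen {z : ℂ} (hz : |z.im| ≤ 3) :
    DifferentiableAt ℂ bernoulliGen z :=
  (differentiable_dslope_exp z).inv (dslope_exp_ne_zero hz)

theorem differentiableOn_limitFactor : DifferentiableOn ℂ limitFactor (halfStrip 3) :=
  DifferentiableOn.deriv (fun _ hz => (differentiableAt_bernoulliGen hz.2.le).differentiableWithinAt)
    (isOpen_halfStrip 3)

theorem measurable_limitFactor : Measurable limitFactor := measurable_deriv _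

/-- Compactness handles Re z ≤ 1. Beyond that, |z/(e^z - 1)| is of order |z|e^{-Re z}, and half of
the decay absorbs |z|. -/
theorem exists_norm_bernoulliGen_le :
    ∃ K : ℝ, 0 < K ∧ ∀ z ∈ halfStrip 3, ‖bernoulliGen z‖ ≤ K * Real.exp (-z.re / 2) := by
  have hc : IsCompact (Set.Icc (-3 : ℝ) 1 ×ℂ Set.Icc (-3 : ℝ) 3) := isCompact_Icc.reProdIm isCompact_Icc
  obtain ⟨C, hC⟩ := hc.exists_bound_of_continuousOn (f := bernoulliGen) (fun z hz =>
    (differentiableAt_bernoulliGen (abs_le.2 hz.2)).continuousAt.continuousWithinAt)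
  refine ⟨max (C * Real.exp (1 / 2)) 24, by positivity, fun z hz => ?_⟩
  by_cases h1 : z.re ≤ 1
  · have hC0 := hC z ⟨⟨hz.1.le, h1⟩, abs_le.1 hz.2.le⟩
    have hCnn : 0 ≤ C := (norm_nonneg _).trans hC0
    calc ‖bernoulliGen z‖ ≤ C * 1 := by simpa using hC0
      _ ≤ C * Real.exp (1 / 2 + -z.re / 2) := by
          gcongr
          exact Real.one_le_exp (by linarith)
      _ = C * Real.exp (1 / 2) * Real.exp (-z.re / 2) := by rw [Real.exp_add]; ring
      _ ≤ _ := by gcongr; exact le_max_left _ _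
  · push Not at h1
    have h0 : z ≠ 0 := by rintro rfl; simp at h1; linarith
    have e1 : Real.exp z.re / 2 ≤ ‖Complex.exp z - 1‖ := by
      have := norm_sub_norm_le (Complex.exp z) 1
      rw [Complex.norm_exp, norm_one] at this
      have := Real.add_one_le_exp z.re
      linarith
    have e2 : ‖z‖ ≤ 12 * Real.exp (z.re / 2) := by
      have := Complex.norm_le_abs_re_add_abs_im z
      rw [abs_of_pos (by linarith)] at this
      have := Real.add_one_le_exp (z.re / 2)
      linarith [hz.2]
    rw [bernoulliGen_of_ne h0, norm_div]
    calc ‖z‖ / ‖Complex.exp z - 1‖ ≤ 12 * Real.exp (z.re / 2) / (Real.exp z.re / 2) := by gcongr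
      _ = 24 * Real.exp (-z.re / 2) := by
          have : Real.exp z.re = Real.exp (z.re / 2) * Real.exp (z.re / 2) := by
            rw [← Real.exp_add]; ring_nf
          rw [this, neg_div, Real.exp_neg]
          field_simp; norm_num
      _ ≤ _ := by gcongr; exact le_max_right _ _

/-- Cauchy's estimate for the derivative on the unit disc about z; the factor e^{1/2} pays for Re w
≥ Re z - 1. -/
theorem exists_norm_limitFactor_le :
    ∃ K : ℝ, 0 < K ∧ ∀ z ∈ halfStrip 2, ‖limitFactor z‖ ≤ K * Real.exp (-z.re / 2) := by
  obtain ⟨K, hK, h⟩ := exists_norm_bernoulliGen_le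
  refine ⟨K * Real.exp (1 / 2), by positivity, fun z hz => ?_⟩
  have hb : ∀ w ∈ Metric.closedBall z 1, w ∈ halfStrip 3 ∧ -1 ≤ w.re - z.re := by
    intro w hw
    rw [Metric.mem_closedBall, dist_eq_norm] at hw
    have h1 := abs_le.1 ((Complex.abs_re_le_norm (w - z)).trans hw)
    have h2 := abs_le.1 ((Complex.abs_im_le_norm (w - z)).trans hw)
    have h3 := abs_lt.1 hz.2
    simp only [sub_re, sub_im] at h1 h2
    exact ⟨⟨by linarith [hz.1, h1.1], abs_lt.2 ⟨by linarith, by linarith⟩⟩, h1.1⟩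
  rw [← div_one (K * _ * _)]
  refine Complex.norm_deriv_le_of_forall_mem_sphere_norm_le one_pos ?_ fun w hw => ?_
  · refine DifferentiableOn.diffContOnCl fun w hw => ?_
    rw [closure_ball _ one_ne_zero] at hw
    exact (differentiableAt_bernoulliGen (hb w hw).1.2.le).differentiableWithinAt
  · have hw' := hb w (Metric.sphere_subset_closedBall hw)
    refine (h w hw'.1).trans ?_
    rw [mul_assoc, ← Real.exp_add]
    gcongr
    linarith [hw'.2]

theorem bernoulliGen_neg {z : ℂ} (hz : |z.im| ≤ 3) : bernoulliGen (-z) = bernoulliGen z + z := by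
  by_cases h0 : z = 0
  · simp [h0]
  rw [bernoulliGen_of_ne h0, bernoulliGen_of_ne (neg_ne_zero.2 h0), Complex.exp_neg]
  have he := Complex.exp_ne_zero z
  have h1 := exp_ne_one_of_abs_im_le h0 hz
  have h2 : Complex.exp z - 1 ≠ 0 := sub_ne_zero.2 h1
  have h3 : 1 - Complex.exp z ≠ 0 := sub_ne_zero.2 (Ne.symm h1)
  have h4 : (Complex.exp z)⁻¹ - 1 = (1 - Complex.exp z) / Complex.exp z := by field_simp
  rw [h4]
  field_simp
  ring

/-- Differentiating B(-z) = B(z) + z at 0 gives -φ(0) = φ(0) + 1. This matches the value (c - 1)/2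
filled in by `kernelFactor` at 0. -/
theorem limitFactor_zero : limitFactor 0 = -1 / 2 := by
  have h1 : HasDerivAt bernoulliGen (limitFactor 0) 0 :=
    (differentiableAt_bernoulliGen (by simp)).hasDerivAt
  have h2 : HasDerivAt (fun z => bernoulliGen (-z)) (-limitFactor 0) 0 := by
    have := HasDerivAt.scomp (0 : ℂ) (h := fun z : ℂ => -z) (g₁ := bernoulliGen)
      (by simpa using h1) (hasDerivAt_neg (0 : ℂ))
    simpa [Function.comp_def] using this
  have h3 := (h1.add (hasDerivAt_id (0 : ℂ))).congr_of_eventuallyEq (f₁ := fun z => bernoulliGen (-z))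
    (by
      filter_upwards [(isOpen_halfStrip 3).mem_nhds (x := 0) (by simp [halfStrip])] with z hz
      exact bernoulliGen_neg hz.2.le)
  have h4 := h2.unique h3
  linear_combination (-1 / 2) * h4

/-- Since c/(e^{cx} - 1) = B(cx)/x, the factor is (B(x) - B(cx))/x, while cx - x = -(1 - c)x. -/
theorem kernelFactor_div_of_ne {c : ℝ} (hc0 : c ≠ 0) (hc : c ≠ 1) {x : ℂ} (hx : x ≠ 0) :
    kernelFactor c x / (1 - c) = slope bernoulliGen x (c * x) := by
  have hc0' : (c : ℂ) ≠ 0 := by exact_mod_cast hc0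
  have hc' : (1 : ℂ) - c ≠ 0 := sub_ne_zero.2 (by exact_mod_cast hc.symm)
  have hc'' : (c : ℂ) - 1 ≠ 0 := sub_ne_zero.2 (by exact_mod_cast hc)
  have h1 : (c : ℂ) * x - x = -((1 - c) * x) := by ring
  rw [slope_def_field, h1, bernoulliGen_of_ne hx, bernoulliGen_of_ne (mul_ne_zero hc0' hx),
    kernelFactor, if_neg hx]
  field_simp
  ring

theorem kernelFactor_div_zero {c : ℝ} (hc : c ≠ 1) :
    kernelFactor c 0 / (1 - c) = limitFactor 0 := by
  have hc' : (1 : ℂ) - c ≠ 0 := sub_ne_zero.2 (by exact_mod_cast hc.symm)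
  rw [limitFactor_zero, kernelFactor, if_pos rfl]
  field_simp
  ring

theorem tendsto_kernelFactor_div {x : ℂ} (hx : x ∈ halfStrip 1) :
    Tendsto (fun c : ℝ => kernelFactor c x / (1 - c)) (𝓝[≠] 1) (𝓝 (limitFactor x)) := by
  have h01 : ∀ᶠ c : ℝ in 𝓝[≠] 1, c ≠ 0 ∧ c ≠ 1 :=
    (eventually_nhdsWithin_of_eventually_nhds (eventually_ne_nhds one_ne_zero)).and
      self_mem_nhdsWithin
  by_cases h0 : x = 0
  · subst h0
    refine tendsto_const_nhds.congr' ?_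
    filter_upwards [h01] with c hc
    exact (kernelFactor_div_zero hc.2).symm
  have h1 : Tendsto (slope bernoulliGen x) (𝓝[≠] x) (𝓝 (limitFactor x)) :=
    hasDerivAt_iff_tendsto_slope.1
      (differentiableAt_bernoulliGen (hx.2.le.trans (by norm_num))).hasDerivAt
  have h2 : Tendsto (fun c : ℝ => (c : ℂ) * x) (𝓝[≠] 1) (𝓝[≠] x) := by
    refine tendsto_nhdsWithin_iff.2 ⟨?_, ?_⟩
    · have : Continuous fun c : ℝ => (c : ℂ) * x := by fun_prop
      simpa using (this.tendsto 1).mono_left nhdsWithin_le_nhds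
    · filter_upwards [h01] with c hc h
      have : (c : ℂ) = 1 := by simpa [h0] using h
      exact hc.2 (by exact_mod_cast this)
  refine (h1.comp h2).congr' ?_
  filter_upwards [h01] with c hc
  exact (kernelFactor_div_of_ne hc.1 hc.2 h0).symm

/-- Mean value inequality for B along the points ax, 1/2 ≤ a ≤ 2. There |φ(ax)| is at most a
constant times e^{-a Re x/2}: the worst a for Re x ≥ 0 is 1/2, which gives the rate 1/4, and for -1
< Re x < 0 the factor e suffices. -/
theorem exists_norm_kernelFactor_div_le :
    ∃ K : ℝ, 0 < K ∧ (∀ x ∈ halfStrip 1, ‖limitFactor x‖ ≤ K * Real.exp (-x.re / 4)) ∧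
      ∀ c : ℝ, 1 / 2 ≤ c → c ≤ 2 → c ≠ 1 → ∀ x ∈ halfStrip 1,
        ‖kernelFactor c x / (1 - c)‖ ≤ K * Real.exp (-x.re / 4) := by
  obtain ⟨K, hK, h⟩ := exists_norm_limitFactor_le
  have key : ∀ a : ℝ, 1 / 2 ≤ a → a ≤ 2 → ∀ x ∈ halfStrip 1, (a : ℂ) * x ∈ halfStrip 2 ∧
      ‖limitFactor (a * x)‖ ≤ K * Real.exp 1 * Real.exp (-x.re / 4) := by
    intro a h1 h2 x hx
    have hre : ((a : ℂ) * x).re = a * x.re := by simp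
    have him : ((a : ℂ) * x).im = a * x.im := by simp
    have hmem : (a : ℂ) * x ∈ halfStrip 2 := by
      refine ⟨?_, ?_⟩
      · rw [hre]; nlinarith [hx.1]
      · rw [him, abs_mul, abs_of_pos (by linarith)]; nlinarith [hx.2, abs_nonneg x.im]
    refine ⟨hmem, (h _ hmem).trans ?_⟩
    rw [mul_assoc, ← Real.exp_add, hre]
    gcongr
    rcases le_total 0 x.re with h3 | h3
    · nlinarith
    · nlinarith [hx.1]
  have key1 : ∀ x ∈ halfStrip 1, ‖limitFactor x‖ ≤ K * Real.exp 1 * Real.exp (-x.re / 4) := by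
    intro x hx
    simpa using (key 1 (by norm_num) (by norm_num) x hx).2
  refine ⟨K * Real.exp 1, by positivity, key1, fun c h1 h2 hc x hx => ?_⟩
  by_cases h0 : x = 0
  · subst h0; rw [kernelFactor_div_zero hc]; exact key1 0 hx
  rw [kernelFactor_div_of_ne (by linarith) hc h0, slope_def_field, norm_div]
  have hne : (c : ℂ) * x - x ≠ 0 := by
    have : (c : ℂ) * x - x = (c - 1) * x := by ring
    rw [this]
    exact mul_ne_zero (sub_ne_zero.2 (by exact_mod_cast hc)) h0
  rw [div_le_iff₀ (norm_pos_iff.2 hne)]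
  have hseg : ∀ y ∈ (fun a : ℝ => (a : ℂ) * x) '' Set.Icc (1 / 2) 2,
      DifferentiableAt ℂ bernoulliGen y ∧
        ‖deriv bernoulliGen y‖ ≤ K * Real.exp 1 * Real.exp (-x.re / 4) := by
    rintro _ ⟨a, ha, rfl⟩
    have := key a ha.1 ha.2 x hx
    exact ⟨differentiableAt_bernoulliGen (this.1.2.le.trans (by norm_num)), this.2⟩
  refine Convex.norm_image_sub_le_of_norm_deriv_le (fun y hy => (hseg y hy).1)
    (fun y hy => (hseg y hy).2) ?_ ⟨1, by norm_num, by simp⟩ ⟨c, ⟨h1, h2⟩, rfl⟩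
  exact (convex_Icc (1 / 2 : ℝ) 2).is_linear_image
    (f := fun a : ℝ => (a : ℂ) * x) ⟨fun a b => by push_cast; ring, fun a b => by simp [mul_assoc]⟩

/-! ### The Hankel contour integral in one variable -/

/-- The factor `t^{s-1} dt/du` on the Hankel contour. -/
def hankelWeight (ε : ℝ) (s : ℂ) (u : ℝ) : ℂ :=
  Complex.exp ((s - 1) * hankelLog ε u) * hankelVelocity ε u

/-- The factor `x^{s-1}` on the positive real axis. -/
def realWeight (s : ℂ) (x : ℝ) : ℂ := Complex.exp ((s - 1) * Real.log x)

theorem hankelPoint_of_neg {ε u : ℝ} (hu : u < 0) : hankelPoint ε u = ((ε - u : ℝ) : ℂ) := by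
  simp [hankelPoint, hankelRadius, hankelArg, hu]

theorem hankelWeight_of_neg {ε u : ℝ} (s : ℂ) (hu : u < 0) :
    hankelWeight ε s u = -realWeight s (ε - u) := by
  simp [hankelWeight, realWeight, hankelLog, hankelVelocity, hankelRadius, hankelArg, hu]

theorem hankelPoint_of_gt {ε u : ℝ} (hu : 2 * Real.pi < u) :
    hankelPoint ε u = ((ε + (u - 2 * Real.pi) : ℝ) : ℂ) := by
  have h0 : ¬ u < 0 := by linarith [Real.pi_pos]
  simp [hankelPoint, hankelRadius, hankelArg, h0, hu.not_ge, Complex.exp_two_pi_mul_I]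

theorem hankelWeight_of_gt {ε u : ℝ} (s : ℂ) (hu : 2 * Real.pi < u) :
    hankelWeight ε s u =
      Complex.exp (2 * Real.pi * I * s) * realWeight s (ε + (u - 2 * Real.pi)) := by
  have h0 : ¬ u < 0 := by linarith [Real.pi_pos]
  simp only [hankelWeight, realWeight, hankelLog, hankelVelocity, hankelRadius, hankelArg, h0,
    hu.not_ge, if_false, mul_one, ← Complex.exp_add]
  rw [Complex.exp_eq_exp_iff_exists_int]
  -- The branch gives e^{2πi(s-1)}, which differs from e^{2πis} by one period.
  exact ⟨-1, by push_cast; ring⟩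

theorem hankelPoint_of_mem {ε u : ℝ} (hε : 0 < ε) (hu : u ∈ Set.Icc 0 (2 * Real.pi)) :
    hankelPoint ε u = Complex.exp (Real.log ε + u * I) := by
  rw [Complex.exp_add, ← Complex.ofReal_exp, Real.exp_log hε]
  simp [hankelPoint, hankelRadius, hankelArg, hu.1.not_gt, hu.2]

/-- In the coordinate w = log t, the form t^{s-1} dt becomes e^{sw} dw, and on the circle dw = i du.
-/
theorem hankelWeight_of_mem {ε u : ℝ} (hε : 0 < ε) (s : ℂ) (hu : u ∈ Set.Icc 0 (2 * Real.pi)) :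
    hankelWeight ε s u = I * Complex.exp (s * (Real.log ε + u * I)) := by
  have h1 : (ε : ℂ) * Complex.exp (u * I) = Complex.exp (Real.log ε + u * I) := by
    rw [Complex.exp_add, ← Complex.ofReal_exp, Real.exp_log hε]
  simp only [hankelWeight, hankelLog, hankelVelocity, hankelRadius, hankelArg, hu.1.not_gt, hu.2,
    if_false, if_true]
  rw [mul_assoc, h1, mul_left_comm, ← Complex.exp_add]
  ring_nf

theorem norm_realWeight {x : ℝ} (hx : 0 < x) (s : ℂ) : ‖realWeight s x‖ = x ^ (s.re - 1) := by
  rw [realWeight, Complex.norm_exp, Real.rpow_def_of_pos hx]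
  congr 1
  simp; ring

theorem measurable_hankelPoint (ε : ℝ) : Measurable (hankelPoint ε) := by
  unfold hankelPoint hankelRadius hankelArg
  have h1 : MeasurableSet {u : ℝ | u < 0} := measurableSet_Iio
  have h2 : MeasurableSet {u : ℝ | u ≤ 2 * Real.pi} := measurableSet_Iic
  refine Measurable.mul (measurable_ofReal.comp ?_)
    (Complex.measurable_exp.comp ((measurable_ofReal.comp ?_).mul_const _))
  · exact Measurable.ite h1 (by fun_prop) (Measurable.ite h2 (by fun_prop) (by fun_prop))
  · exact Measurable.ite h1 (by fun_prop) (Measurable.ite h2 (by fun_prop) (by fun_prop))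

theorem measurable_hankelWeight (ε : ℝ) (s : ℂ) : Measurable (hankelWeight ε s) := by
  unfold hankelWeight hankelLog hankelVelocity hankelRadius hankelArg
  have h1 : MeasurableSet {u : ℝ | u < 0} := measurableSet_Iio
  have h2 : MeasurableSet {u : ℝ | u ≤ 2 * Real.pi} := measurableSet_Iic
  refine Measurable.mul (Complex.measurable_exp.comp (Measurable.const_mul (Measurable.add
    (measurable_ofReal.comp (Real.measurable_log.comp ?_))
    ((measurable_ofReal.comp ?_).mul_const _)) _)) ?_
  · exact Measurable.ite h1 (by fun_prop) (Measurable.ite h2 (by fun_prop) (by fun_prop))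
  · exact Measurable.ite h1 (by fun_prop) (Measurable.ite h2 (by fun_prop) (by fun_prop))
  · exact Measurable.ite h1 (by fun_prop) (Measurable.ite h2 (by fun_prop) (by fun_prop))

theorem measurable_realWeight (s : ℂ) : Measurable (realWeight s) := by
  unfold realWeight; fun_prop

theorem exp_mem_halfStrip {δ : ℝ} {w : ℂ} (h : Real.exp w.re < δ) :
    Complex.exp w ∈ halfStrip δ := by
  rw [← Complex.norm_exp] at h
  exact ⟨by linarith [(abs_le.1 (Complex.abs_re_le_norm (Complex.exp w))).1],
    (Complex.abs_im_le_norm _).trans_lt h⟩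

theorem hankelPoint_mem_halfStrip {δ ε : ℝ} (hε : 0 < ε) (hδ : ε < δ) (u : ℝ) :
    hankelPoint ε u ∈ halfStrip δ := by
  rcases lt_or_ge u 0 with h | h
  · rw [hankelPoint_of_neg h]; exact ofReal_mem_halfStrip (hε.trans hδ) (by linarith)
  rcases lt_or_ge (2 * Real.pi) u with h' | h'
  · rw [hankelPoint_of_gt h']; exact ofReal_mem_halfStrip (hε.trans hδ) (by linarith)
  · rw [hankelPoint_of_mem hε ⟨h, h'⟩]
    exact exp_mem_halfStrip (by simpa [Real.exp_log hε] using hδ)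

/-! ### Transport between the two rays of the contour and the half-line (ε, ∞). -/

theorem integrableOn_Iio_comp_sub {E : Type*} [NormedAddCommGroup E] (ε : ℝ) {f : ℝ → E} :
    IntegrableOn (fun u => f (ε - u)) (Set.Iio 0) ↔ IntegrableOn f (Set.Ioi ε) := by
  have := (Measure.measurePreserving_sub_left volume ε).integrableOn_comp_preimage
    (MeasurableEquiv.subLeft ε).measurableEmbedding (f := f) (s := Set.Ioi ε)
  simpa [Function.comp_def] using this

theorem integrableOn_Ioi_comp_add {E : Type*} [NormedAddCommGroup E] (ε a : ℝ) {f : ℝ → E} :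
    IntegrableOn (fun u => f (ε + (u - a))) (Set.Ioi a) ↔ IntegrableOn f (Set.Ioi ε) := by
  have := (measurePreserving_add_left volume (ε - a)).integrableOn_comp_preimage
    (MeasurableEquiv.addLeft (ε - a)).measurableEmbedding (f := f) (s := Set.Ioi ε)
  rw [← this]
  have h1 : (fun x => ε - a + x) ⁻¹' Set.Ioi ε = Set.Ioi a := by ext x; simp
  rw [h1]
  simp [Function.comp_def, add_sub, sub_add_eq_add_sub]

theorem setIntegral_Iio_comp_sub (ε : ℝ) (f : ℝ → ℂ) :
    ∫ u in Set.Iio 0, f (ε - u) = ∫ x in Set.Ioi ε, f x := by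
  have := (Measure.measurePreserving_sub_left volume ε).setIntegral_preimage_emb
    (MeasurableEquiv.subLeft ε).measurableEmbedding f (Set.Ioi ε)
  simpa using this

theorem setIntegral_Ioi_comp_add (ε a : ℝ) (f : ℝ → ℂ) :
    ∫ u in Set.Ioi a, f (ε + (u - a)) = ∫ x in Set.Ioi ε, f x := by
  have := (measurePreserving_add_left volume (ε - a)).setIntegral_preimage_emb
    (MeasurableEquiv.addLeft (ε - a)).measurableEmbedding f (Set.Ioi ε)
  rw [← this]
  have h1 : (fun x => ε - a + x) ⁻¹' Set.Ioi ε = Set.Ioi a := by ext x; simp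
  rw [h1]
  simp [add_sub, sub_add_eq_add_sub]

theorem integrableOn_realWeight {s : ℂ} (hs : 0 < s.re) :
    IntegrableOn (fun x : ℝ => Real.exp (-x / 4) * ‖realWeight s x‖) (Set.Ioi 0) := by
  have := integrableOn_rpow_mul_exp_neg_mul_rpow (p := 1) (s := s.re - 1) (b := 1 / 4)
    (by linarith) one_pos (by norm_num)
  refine this.congr_fun (fun x hx => ?_) measurableSet_Ioi
  simp only [Real.rpow_one]
  rw [norm_realWeight hx, mul_comm]
  ring_nf

theorem integrable_hankelWeight {s : ℂ} (hs : 0 < s.re) {ε : ℝ} (hε : 0 < ε) :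
    Integrable (fun u : ℝ => Real.exp (-(hankelPoint ε u).re / 4) * ‖hankelWeight ε s u‖) := by
  have h0 := (integrableOn_realWeight hs).mono_set (Set.Ioi_subset_Ioi hε.le)
  have huniv : (Set.univ : Set ℝ) = Set.Iio 0 ∪ (Set.Icc 0 (2 * Real.pi) ∪ Set.Ioi (2 * Real.pi)) := by
    ext x
    simp only [Set.mem_univ, Set.mem_union, Set.mem_Iio, Set.mem_Icc, Set.mem_Ioi, true_iff]
    rcases lt_or_ge x 0 with h | h
    · exact Or.inl h
    · exact Or.inr ((le_or_gt x (2 * Real.pi)).imp (fun h' => ⟨h, h'⟩) id)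
  rw [← integrableOn_univ, huniv]
  refine IntegrableOn.union ?_ (IntegrableOn.union ?_ ?_)
  · refine ((integrableOn_Iio_comp_sub ε).2 h0).congr_fun (fun u hu => ?_) measurableSet_Iio
    simp only [hankelPoint_of_neg hu, hankelWeight_of_neg s hu, ofReal_re, norm_neg]
  · have hc : Continuous fun u : ℝ => Real.exp (-(Complex.exp (Real.log ε + u * I)).re / 4) *
        ‖I * Complex.exp (s * (Real.log ε + u * I))‖ := by
      have : Continuous fun u : ℝ => (Complex.exp (Real.log ε + u * I)).re :=
        continuous_re.comp (by fun_prop)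
      fun_prop
    refine (hc.continuousOn.integrableOn_Icc).congr_fun (fun u hu => ?_) measurableSet_Icc
    simp only [hankelPoint_of_mem hε hu, hankelWeight_of_mem hε s hu]
  · refine IntegrableOn.congr_fun (Integrable.const_mul
      ((integrableOn_Ioi_comp_add ε (2 * Real.pi)).2 h0) ‖Complex.exp (2 * Real.pi * I * s)‖) (fun u hu => ?_) measurableSet_Ioi
    simp only [hankelPoint_of_gt hu, hankelWeight_of_gt s hu, ofReal_re, norm_mul]
    ring

theorem ofReal_continuousOn {f : ℂ → ℂ} {δ : ℝ} (hδ : 0 < δ)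
    (hf : DifferentiableOn ℂ f (halfStrip δ)) :
    ContinuousOn (fun x : ℝ => f x) (Set.Ioi 0) :=
  hf.continuousOn.comp continuous_ofReal.continuousOn fun _ hx => ofReal_mem_halfStrip hδ hx

theorem continuousOn_realWeight (s : ℂ) : ContinuousOn (realWeight s) (Set.Ioi 0) := by
  unfold realWeight
  have : ContinuousOn (fun x : ℝ => Real.log x) (Set.Ioi 0) :=
    Real.continuousOn_log.mono fun x hx => ne_of_gt hx
  fun_prop

/-- Cauchy's theorem for `f(t) t^{s-1}` between two circles around the branch point. -/
theorem circle_sub_circle {f : ℂ → ℂ} {δ ε η : ℝ} (hf : DifferentiableOn ℂ f (halfStrip δ))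
    (hη : 0 < η) (hηε : η ≤ ε) (hεδ : ε < δ) (s : ℂ) :
    (I * ∫ u in (0 : ℝ)..2 * Real.pi, f (Complex.exp (Real.log ε + u * I)) *
        Complex.exp (s * (Real.log ε + u * I))) -
      (I * ∫ u in (0 : ℝ)..2 * Real.pi, f (Complex.exp (Real.log η + u * I)) *
        Complex.exp (s * (Real.log η + u * I))) =
      (Complex.exp (2 * Real.pi * I * s) - 1) * ∫ x in η..ε, f x * realWeight s x := by
  have hε : 0 < ε := hη.trans_le hηε
  -- In w = log t the slit annulus becomes the rectangle [log η, log ε] × [0, 2π], so the branch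
  -- point disappears.
  set g : ℂ → ℂ := fun w => f (Complex.exp w) * Complex.exp (s * w) with hg
  have hrect := Complex.integral_boundary_rect_eq_zero_of_differentiableOn g
    (Real.log η) (Real.log ε + (2 * Real.pi : ℝ) * I) (by
      refine DifferentiableOn.mul (hf.comp Complex.differentiable_exp.differentiableOn ?_)
        (by fun_prop)
      intro w hw
      refine exp_mem_halfStrip (lt_of_le_of_lt ?_ hεδ)
      have h1 : w.re ∈ Set.uIcc (Real.log η) (Real.log ε) := by simpa using hw.1
      rw [Set.uIcc_of_le (Real.log_le_log hη hηε)] at h1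
      rw [← Real.exp_log hε]
      exact Real.exp_le_exp.2 h1.2)
  -- The top side lies one period of `exp` above the bottom side, so only e^{sw} changes; this is
  -- the source of e^{2πis} - 1.
  have htop : ∀ x : ℝ, g (x + (2 * Real.pi : ℝ) * I) = Complex.exp (2 * Real.pi * I * s) * g x := by
    intro x
    have h1 : Complex.exp ((x : ℂ) + (2 * Real.pi : ℝ) * I) = Complex.exp x := by
      push_cast; exact Complex.exp_periodic x
    have h2 : s * ((x : ℂ) + (2 * Real.pi : ℝ) * I) = 2 * Real.pi * I * s + s * x := by
      push_cast; ring
    simp only [hg]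
    rw [h1, h2, Complex.exp_add]
    ring
  have hbot : ∫ x in Real.log η..Real.log ε, g x = ∫ x in η..ε, f x * realWeight s x := by
    have hmap : ∀ y ∈ Real.exp '' Set.uIcc (Real.log η) (Real.log ε), y ∈ Set.Ioi (0 : ℝ) := by
      rintro _ ⟨x, -, rfl⟩
      exact Real.exp_pos x
    have := intervalIntegral.integral_deriv_smul_comp' (a := Real.log η) (b := Real.log ε)
      (f := Real.exp) (f' := Real.exp) (g := fun x : ℝ => f x * realWeight s x)
      (fun x _ => Real.hasDerivAt_exp x) Real.continuous_exp.continuousOn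
      (((ofReal_continuousOn (hε.trans hεδ) hf).mul (continuousOn_realWeight s)).mono hmap)
    rw [Real.exp_log hη, Real.exp_log hε] at this
    rw [← this]
    refine intervalIntegral.integral_congr fun x _ => ?_
    simp only [hg, Function.comp_apply, realWeight, Real.log_exp, real_smul, ofReal_exp]
    rw [mul_left_comm, ← Complex.exp_add]
    ring_nf
  simp only [add_re, add_im, mul_re, mul_im, ofReal_re, ofReal_im, I_re, I_im, mul_zero, mul_one,
    sub_zero, zero_add, add_zero, htop, intervalIntegral.integral_const_mul, ofReal_zero, zero_mul,
    smul_eq_mul, hbot] at hrect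
  linear_combination hrect

/-- The integrand is O(η^{Re s}) on the circle of radius η. -/
theorem tendsto_circle {f : ℂ → ℂ} {δ C : ℝ} (hδ : 0 < δ) (hC : ∀ z ∈ halfStrip δ, ‖f z‖ ≤ C)
    {s : ℂ} (hs : 0 < s.re) :
    Tendsto (fun η : ℝ => I * ∫ u in (0 : ℝ)..2 * Real.pi, f (Complex.exp (Real.log η + u * I)) *
        Complex.exp (s * (Real.log η + u * I))) (𝓝[>] 0) (𝓝 0) := by
  have hlim : Tendsto (fun η : ℝ => C * (η ^ s.re * Real.exp (|s.im| * (2 * Real.pi))) *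
      |2 * Real.pi - 0|) (𝓝[>] 0) (𝓝 0) := by
    have : Tendsto (fun η : ℝ => η ^ s.re) (𝓝[>] 0) (𝓝 0) := by
      have := (Real.continuousAt_rpow_const 0 s.re (Or.inr hs.le)).tendsto
      rw [Real.zero_rpow hs.ne'] at this
      exact this.mono_left nhdsWithin_le_nhds
    simpa using ((this.mul_const _).const_mul C).mul_const |2 * Real.pi - 0|
  refine squeeze_zero_norm' ?_ hlim
  filter_upwards [Ioo_mem_nhdsGT hδ] with η hη
  rw [norm_mul, norm_I, one_mul]
  refine intervalIntegral.norm_integral_le_of_norm_le_const fun u hu => ?_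
  rw [Set.uIoc_of_le Real.two_pi_pos.le] at hu
  rw [norm_mul]
  have hfC := hC _ (exp_mem_halfStrip (w := Real.log η + u * I) (δ := δ)
    (by simpa [Real.exp_log hη.1] using hη.2))
  have hC0 : 0 ≤ C := (norm_nonneg _).trans hfC
  gcongr
  rw [Complex.norm_exp, Real.rpow_def_of_pos hη.1, ← Real.exp_add]
  gcongr
  have : (s * (Real.log η + u * I)).re = Real.log η * s.re - s.im * u := by simp; ring
  rw [this]
  have h1 : -s.im * u ≤ |s.im| * (2 * Real.pi) :=
    mul_le_mul (neg_le_abs _) hu.2 hu.1.le (abs_nonneg _)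
  linarith

theorem integrableOn_mul_realWeight {f : ℂ → ℂ} {δ K : ℝ} (hδ : 0 < δ)
    (hf : DifferentiableOn ℂ f (halfStrip δ))
    (hK : ∀ z ∈ halfStrip δ, ‖f z‖ ≤ K * Real.exp (-z.re / 4)) {s : ℂ} (hs : 0 < s.re) :
    IntegrableOn (fun x : ℝ => f x * realWeight s x) (Set.Ioi 0) := by
  refine ((integrableOn_realWeight hs).const_mul K).mono'
    (((ofReal_continuousOn hδ hf).mul (continuousOn_realWeight s)).aestronglyMeasurable
      measurableSet_Ioi) ?_
  filter_upwards [ae_restrict_mem measurableSet_Ioi] with x hx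
  rw [norm_mul, ← mul_assoc]
  gcongr
  simpa using hK x (ofReal_mem_halfStrip hδ hx)

/-- Collapsing the Hankel contour onto the positive real axis. -/
theorem integral_hankel_eq {f : ℂ → ℂ} {δ ε K : ℝ} (hε : 0 < ε) (hδ : ε < δ)
    (hf : DifferentiableOn ℂ f (halfStrip δ))
    (hK : ∀ z ∈ halfStrip δ, ‖f z‖ ≤ K * Real.exp (-z.re / 4)) {s : ℂ} (hs : 0 < s.re) :
    ∫ u : ℝ, f (hankelPoint ε u) * hankelWeight ε s u =
      (Complex.exp (2 * Real.pi * I * s) - 1) * ∫ x in Set.Ioi (0 : ℝ), f x * realWeight s x := by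
  have hδ0 := hε.trans hδ
  have hK0 : 0 ≤ K := by
    have := (norm_nonneg _).trans (hK 0 (by simp [halfStrip, hδ0]))
    simpa using this
  have hint := integrableOn_mul_realWeight hδ0 hf hK hs
  -- Let η → 0 in `circle_sub_circle`: the small circle vanishes and the segment becomes [0, ε].
  have hcircle : (I * ∫ u in (0 : ℝ)..2 * Real.pi, f (Complex.exp (Real.log ε + u * I)) *
        Complex.exp (s * (Real.log ε + u * I))) =
      (Complex.exp (2 * Real.pi * I * s) - 1) * ∫ x in (0 : ℝ)..ε, f x * realWeight s x := by
    have h1 := tendsto_circle (C := K * Real.exp (δ / 4)) hδ0 (fun z hz => (hK z hz).trans (by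
      gcongr; linarith [hz.1])) hs
    have h2 : Tendsto (fun η : ℝ => ∫ x in η..ε, f x * realWeight s x) (𝓝[>] 0)
        (𝓝 (∫ x in (0 : ℝ)..ε, f x * realWeight s x)) := by
      have h3 : IntegrableOn (fun x : ℝ => f x * realWeight s x) (Set.uIcc 0 ε) := by
        rw [Set.uIcc_of_le hε.le, integrableOn_Icc_iff_integrableOn_Ioc]
        exact hint.mono_set Set.Ioc_subset_Ioi_self
      have h4 := intervalIntegral.continuousOn_primitive_interval_left h3 0 Set.left_mem_uIcc
      rw [Set.uIcc_of_le hε.le] at h4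
      refine h4.tendsto.mono_left ?_
      rw [← nhdsWithin_Ioc_eq_nhdsGT hε]
      exact nhdsWithin_mono _ Set.Ioc_subset_Icc_self
    have h3 := (h1.const_sub (I * ∫ u in (0 : ℝ)..2 * Real.pi,
      f (Complex.exp (Real.log ε + u * I)) * Complex.exp (s * (Real.log ε + u * I)))).congr' (by
        filter_upwards [Ioo_mem_nhdsGT hε] with η hη
        exact circle_sub_circle hf hη.1 hη.2.le hδ s)
    have h4 := tendsto_nhds_unique h3 (h2.const_mul _)
    simpa using h4
  have hH : Integrable fun u : ℝ => f (hankelPoint ε u) * hankelWeight ε s u := by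
    -- Regularity of `f` is known only on the half-strip, so measurability goes through the
    -- restriction to it.
    have hmeas : Measurable fun u => f (hankelPoint ε u) := by
      have h1 : Measurable ((halfStrip δ).domRestrict f) :=
        (continuousOn_iff_continuous_domRestrict.1 hf.continuousOn).measurable
      exact h1.comp (((measurable_hankelPoint ε).subtype_mk
        (h := fun u => hankelPoint_mem_halfStrip hε hδ u)))
    refine ((integrable_hankelWeight hs hε).const_mul K).mono'
      (hmeas.mul (measurable_hankelWeight ε s)).aestronglyMeasurable (ae_of_all _ fun u => ?_)
    rw [norm_mul, ← mul_assoc]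
    gcongr
    exact hK _ (hankelPoint_mem_halfStrip hε hδ u)
  have hA : ∫ u in Set.Iio 0, f (hankelPoint ε u) * hankelWeight ε s u =
      -∫ x in Set.Ioi ε, f x * realWeight s x := by
    rw [← setIntegral_Iio_comp_sub, ← integral_neg]
    refine setIntegral_congr_fun measurableSet_Iio fun u hu => ?_
    simp only [hankelPoint_of_neg hu, hankelWeight_of_neg s hu]
    ring
  have hB : ∫ u in Set.Ioi (2 * Real.pi), f (hankelPoint ε u) * hankelWeight ε s u =
      Complex.exp (2 * Real.pi * I * s) * ∫ x in Set.Ioi ε, f x * realWeight s x := by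
    rw [← setIntegral_Ioi_comp_add ε (2 * Real.pi), ← integral_const_mul]
    refine setIntegral_congr_fun measurableSet_Ioi fun u hu => ?_
    simp only [hankelPoint_of_gt hu, hankelWeight_of_gt s hu]
    ring
  have hM : ∫ u in Set.Icc 0 (2 * Real.pi), f (hankelPoint ε u) * hankelWeight ε s u =
      (Complex.exp (2 * Real.pi * I * s) - 1) * ∫ x in (0 : ℝ)..ε, f x * realWeight s x := by
    rw [← hcircle, ← intervalIntegral.integral_const_mul, intervalIntegral.integral_of_le
      Real.two_pi_pos.le, integral_Icc_eq_integral_Ioc]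
    refine setIntegral_congr_fun measurableSet_Ioc fun u hu => ?_
    simp only [hankelPoint_of_mem hε ⟨hu.1.le, hu.2⟩, hankelWeight_of_mem hε s ⟨hu.1.le, hu.2⟩]
    ring
  have hsplit : ∫ u : ℝ, f (hankelPoint ε u) * hankelWeight ε s u =
      (∫ u in Set.Iio 0, f (hankelPoint ε u) * hankelWeight ε s u) +
      ((∫ u in Set.Icc 0 (2 * Real.pi), f (hankelPoint ε u) * hankelWeight ε s u) +
      ∫ u in Set.Ioi (2 * Real.pi), f (hankelPoint ε u) * hankelWeight ε s u) := by
    have h1 : Set.Icc 0 (2 * Real.pi) ∪ Set.Ioi (2 * Real.pi) = Set.Ici 0 :=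
      Set.Icc_union_Ioi_eq_Ici Real.two_pi_pos.le
    rw [← setIntegral_union (Set.disjoint_left.2 fun x h h' => (h.2.trans_lt h').false)
      measurableSet_Ioi hH.integrableOn hH.integrableOn, h1, ← Set.compl_Iio,
      integral_add_compl measurableSet_Iio hH]
  have hray : ∫ x in Set.Ioi (0 : ℝ), f x * realWeight s x =
      (∫ x in (0 : ℝ)..ε, f x * realWeight s x) + ∫ x in Set.Ioi ε, f x * realWeight s x := by
    rw [intervalIntegral.integral_of_le hε.le, ← setIntegral_union
      (Set.Ioc_disjoint_Ioi le_rfl) measurableSet_Ioi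
      (hint.mono_set Set.Ioc_subset_Ioi_self) (hint.mono_set (Set.Ioi_subset_Ioi hε.le)),
      Set.Ioc_union_Ioi_eq_Ioi hε.le]
  rw [hsplit, hA, hB, hM, hray]
  ring

/-! ### Changing the contour in several variables -/

theorem measurable_finCons {α : Type*} [MeasurableSpace α] {r : ℕ} :
    Measurable fun z : α × (Fin r → α) => (Fin.cons z.1 z.2 : Fin (r + 1) → α) := by
  rw [measurable_pi_iff]
  intro i
  refine Fin.cases ?_ (fun j => ?_) i
  · simpa using measurable_fst
  · simpa [Function.comp_def] using (measurable_pi_apply j).comp measurable_snd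

theorem measurePreserving_finCons {r : ℕ} (μ : Measure ℝ) [SigmaFinite μ] :
    MeasurePreserving (MeasurableEquiv.piFinSuccAbove (fun _ : Fin (r + 1) => ℝ) 0).symm
      (μ.prod (Measure.pi fun _ : Fin r => μ)) (Measure.pi fun _ : Fin (r + 1) => μ) :=
  (measurePreserving_piFinSuccAbove (fun _ : Fin (r + 1) => μ) 0).symm

theorem integral_pi_succ {r : ℕ} (μ : Measure ℝ) [SigmaFinite μ] (F : (Fin (r + 1) → ℝ) → ℂ) :
    ∫ u, F u ∂(Measure.pi fun _ : Fin (r + 1) => μ) =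
      ∫ z, F (Fin.cons z.1 z.2) ∂(μ.prod (Measure.pi fun _ : Fin r => μ)) := by
  simpa [MeasurableEquiv.piFinSuccAbove, Fin.insertNthEquiv] using
    ((measurePreserving_finCons μ).integral_comp' F).symm

theorem ae_forall_pi {r : ℕ} {μ : Measure ℝ} [SigmaFinite μ] {P : ℝ → Prop}
    (h : ∀ᵐ x ∂μ, P x) : ∀ᵐ x ∂(Measure.pi fun _ : Fin r => μ), ∀ i, P (x i) :=
  eventually_all.2 fun i => (Measure.tendsto_eval_ae_ae (i := i)).eventually h

theorem ae_prod_and {α β : Type*} [MeasurableSpace α] [MeasurableSpace β] {μ : Measure α}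
    {ν : Measure β} [SFinite ν] {P : α → Prop} {Q : β → Prop} (hP : ∀ᵐ x ∂μ, P x)
    (hQ : ∀ᵐ y ∂ν, Q y) : ∀ᵐ z ∂(μ.prod ν), P z.1 ∧ Q z.2 :=
  (Measure.quasiMeasurePreserving_fst.ae hP).and (Measure.quasiMeasurePreserving_snd.ae hQ)

theorem integrable_mul_prod_weight {r : ℕ} {μ : Measure ℝ} [SigmaFinite μ] {p : ℝ → ℂ}
    (hp : Measurable p) {D : Set ℂ} (hpD : ∀ᵐ u ∂μ, p u ∈ D) {w : Fin r → ℝ → ℂ}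
    (hw : ∀ k, Measurable (w k)) {b : ℂ → ℝ}
    (hint : ∀ k, Integrable (fun u => b (p u) * ‖w k u‖) μ)
    {G : (Fin r → ℂ) → ℂ} (hG : Measurable G) {K : ℝ}
    (hb : ∀ t, (∀ i, t i ∈ D) → ‖G t‖ ≤ K * ∏ i, b (t i)) :
    Integrable (fun u : Fin r → ℝ => G (fun k => p (u k)) * ∏ k, w k (u k))
      (Measure.pi fun _ => μ) := by
  refine ((Integrable.fintype_prod (μ := fun _ : Fin r => μ) hint).const_mul K).mono' ?_ ?_
  · refine Measurable.aestronglyMeasurable ((hG.comp (measurable_pi_lambda _ fun k =>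
      hp.comp (measurable_pi_apply k))).mul ?_)
    exact Finset.measurable_prod _ fun k _ => (hw k).comp (measurable_pi_apply k)
  · filter_upwards [ae_forall_pi hpD] with u hu
    rw [norm_mul, norm_prod, Finset.prod_mul_distrib, ← mul_assoc]
    gcongr
    exact hb _ hu

/-- One variable runs over `p` and the others over `q`: the mixed position needed for Fubini between
the two stages of the contour change. Taking `p = q` covers the unmixed positions. -/
theorem integrable_finCons_weight {r : ℕ} {μ ν : Measure ℝ} [SigmaFinite μ] [SigmaFinite ν]
    {p q : ℝ → ℂ} (hp : Measurable p) (hq : Measurable q) {D : Set ℂ}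
    (hpD : ∀ᵐ u ∂μ, p u ∈ D) (hqD : ∀ᵐ x ∂ν, q x ∈ D) {w : ℝ → ℂ} {v : Fin r → ℝ → ℂ}
    (hw : Measurable w) (hv : ∀ k, Measurable (v k)) {b : ℂ → ℝ}
    (hint : Integrable (fun u => b (p u) * ‖w u‖) μ)
    (hint' : ∀ k, Integrable (fun x => b (q x) * ‖v k x‖) ν)
    {G : (Fin (r + 1) → ℂ) → ℂ} (hG : Measurable G) {K : ℝ}
    (hb : ∀ t, (∀ i, t i ∈ D) → ‖G t‖ ≤ K * ∏ i, b (t i)) :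
    Integrable (fun z : ℝ × (Fin r → ℝ) => G (Fin.cons (p z.1) fun k => q (z.2 k)) *
      (w z.1 * ∏ k, v k (z.2 k))) (μ.prod (Measure.pi fun _ => ν)) := by
  have h1 := hint.mul_prod (Integrable.fintype_prod (μ := fun _ : Fin r => ν) hint')
  refine (h1.const_mul K).mono' ?_ ?_
  · refine Measurable.aestronglyMeasurable ((hG.comp (measurable_finCons.comp
      ((hp.comp measurable_fst).prodMk (measurable_pi_lambda _ fun k =>
        hq.comp ((measurable_pi_apply k).comp measurable_snd))))).mul ?_)
    exact (hw.comp measurable_fst).mul (Finset.measurable_prod _ fun k _ =>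
      (hv k).comp ((measurable_pi_apply k).comp measurable_snd))
  · filter_upwards [ae_prod_and hpD (ae_forall_pi hqD)] with z hz
    have := hb (Fin.cons (p z.1) fun k => q (z.2 k)) (fun i => by
      refine Fin.cases ?_ (fun j => ?_) i
      · simpa using hz.1
      · simpa using hz.2 j)
    rw [Fin.prod_univ_succ] at this
    simp only [Fin.cons_zero, Fin.cons_succ] at this
    rw [norm_mul, norm_mul, norm_prod, Finset.prod_mul_distrib]
    calc _ ≤ (K * (b (p z.1) * ∏ k, b (q (z.2 k)))) * (‖w z.1‖ * ∏ k, ‖v k (z.2 k)‖) := by gcongr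
      _ = _ := by ring

/-- If a one-variable contour change is allowed in each variable separately, it is allowed in all
of them simultaneously. -/
theorem integral_pi_contour_change {μ ν : Measure ℝ} [SigmaFinite μ] [SigmaFinite ν]
    {p q : ℝ → ℂ} (hp : Measurable p) (hq : Measurable q) {D : Set ℂ} (hD : D.Nonempty)
    (hpD : ∀ᵐ u ∂μ, p u ∈ D) (hqD : ∀ᵐ x ∂ν, q x ∈ D) {b : ℂ → ℝ} :
    ∀ {r : ℕ} {w v : Fin r → ℝ → ℂ}, (∀ k, Measurable (w k)) → (∀ k, Measurable (v k)) →
    (∀ k, Integrable (fun u => b (p u) * ‖w k u‖) μ) →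
    (∀ k, Integrable (fun x => b (q x) * ‖v k x‖) ν) →
    ∀ {G : (Fin r → ℂ) → ℂ}, Measurable G → ∀ {K : ℝ},
    (∀ t, (∀ i, t i ∈ D) → ‖G t‖ ≤ K * ∏ i, b (t i)) →
    (∀ k t, (∀ i, t i ∈ D) → ∫ u, G (Function.update t k (p u)) * w k u ∂μ =
      ∫ x, G (Function.update t k (q x)) * v k x ∂ν) →
    ∫ u, G (fun k => p (u k)) * ∏ k, w k (u k) ∂(Measure.pi fun _ => μ) =
      ∫ x, G (fun k => q (x k)) * ∏ k, v k (x k) ∂(Measure.pi fun _ => ν) := by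
  intro r
  induction r with
  | zero =>
    intro w v _ _ _ _ G _ K _ _
    have h1 : ∀ u : Fin 0 → ℝ, (fun k => p (u k)) = fun k => q (u k) :=
      fun u => funext fun k => k.elim0
    simp only [h1, Finset.univ_eq_empty, Finset.prod_empty, mul_one]
    rw [Measure.pi_of_empty, Measure.pi_of_empty]
  | succ r ih =>
    intro w v hw hv hwi hvi G hG K hb h1
    have hcons : ∀ {F : ℝ → ℂ} (a : ℝ) (t : Fin r → ℝ),
        (fun k => F ((Fin.cons a t : Fin (r + 1) → ℝ) k)) = Fin.cons (F a) fun k => F (t k) := by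
      intro F a t
      funext k
      refine Fin.cases ?_ (fun j => ?_) k <;> simp
    have hmem : ∀ {a : ℂ} {t : Fin r → ℂ}, a ∈ D → (∀ i, t i ∈ D) →
        ∀ i, (Fin.cons a t : Fin (r + 1) → ℂ) i ∈ D := by
      intro a t ha ht i
      refine Fin.cases ?_ (fun j => ?_) i
      · simpa using ha
      · simpa using ht j
    have hIμμ := integrable_finCons_weight hp hp hpD hpD (hw 0) (fun k => hw k.succ) (hwi 0)
      (fun k => hwi k.succ) hG hb
    have hIμν := integrable_finCons_weight hp hq hpD hqD (hw 0) (fun k => hv k.succ) (hwi 0)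
      (fun k => hvi k.succ) hG hb
    have hIνν := integrable_finCons_weight hq hq hqD hqD (hv 0) (fun k => hv k.succ) (hvi 0)
      (fun k => hvi k.succ) hG hb
    rw [integral_pi_succ, integral_pi_succ]
    simp only [hcons, Fin.prod_univ_succ, Fin.cons_zero, Fin.cons_succ]
    rw [integral_prod _ hIμμ]
    calc _ = ∫ a, ∫ t, G (Fin.cons (p a) fun k => q (t k)) * (w 0 a * ∏ k : Fin r, v k.succ (t k))
          ∂(Measure.pi fun _ => ν) ∂μ := by
          refine integral_congr_ae ?_
          filter_upwards [hpD] with a ha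
          -- With the head frozen at `p a` on the old contour, the tail moves by induction; the
          -- bound gains the factor `b (p a)`.
          have := ih (G := fun t => G (Fin.cons (p a) t)) (fun k => hw k.succ) (fun k => hv k.succ)
            (fun k => hwi k.succ) (fun k => hvi k.succ)
            (hG.comp (measurable_finCons.comp measurable_prodMk_left)) (K := K * b (p a))
            (fun t ht => by
              have := hb _ (hmem ha ht)
              simpa [Fin.prod_univ_succ, mul_assoc] using this)
            (fun k t ht => by
              have := h1 k.succ _ (hmem ha ht)
              simpa only [← Fin.cons_update] using this)
          simp only [mul_left_comm _ (w 0 a), integral_const_mul]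
          rw [this]
      _ = ∫ t, ∫ a, G (Fin.cons (p a) fun k => q (t k)) * (w 0 a * ∏ k : Fin r, v k.succ (t k))
          ∂μ ∂(Measure.pi fun _ => ν) := integral_integral_swap hIμν
      _ = ∫ t, ∫ a, G (Fin.cons (q a) fun k => q (t k)) * (v 0 a * ∏ k : Fin r, v k.succ (t k))
          ∂ν ∂(Measure.pi fun _ => ν) := by
          -- The one-variable hypothesis wants a full point of `D`; its coordinate 0 gets
          -- overwritten, so any `d` will do.
          obtain ⟨d, hd⟩ := hD
          refine integral_congr_ae ?_
          filter_upwards [ae_forall_pi hqD] with t ht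
          have := h1 0 _ (hmem hd ht)
          simp only [Fin.update_cons_zero] at this
          simp only [← mul_assoc, integral_mul_const]
          rw [this]
      _ = _ := by
          rw [integral_prod_symm _ hIνν]

/-! ### The limit kernel -/

/-- The limit of `kernel r c / (1 - c)^r` as `c → 1`. -/
def limitKernel (r : ℕ) (t : Fin r → ℂ) : ℂ := ∏ j : Fin r, limitFactor (∑ k ∈ Finset.Ici j, t k)

theorem measurable_sum_Ici {r : ℕ} (j : Fin r) :
    Measurable fun t : Fin r → ℂ => ∑ k ∈ Finset.Ici j, t k :=
  Finset.measurable_sum _ fun k _ => measurable_pi_apply k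

theorem measurable_limitKernel (r : ℕ) : Measurable (limitKernel r) :=
  Finset.measurable_prod _ fun j _ => measurable_limitFactor.comp (measurable_sum_Ici j)

theorem measurable_kernel (r : ℕ) (c : ℝ) : Measurable (kernel r c) := by
  have h : Measurable (kernelFactor c) :=
    Measurable.ite (measurableSet_singleton 0) measurable_const (by fun_prop)
  exact Finset.measurable_prod _ fun j _ => h.comp (measurable_sum_Ici j)

/-- A sum of at most r terms, each losing less than δ = 1/(r+1), stays within width 1. The terms
other than t_j lower the real part by at most 1, so the j-th factor keeps its decay in t_j. -/
theorem sum_Ici_mem_halfStrip {r : ℕ} {t : Fin r → ℂ}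
    (ht : ∀ i, t i ∈ halfStrip (1 / ((r : ℝ) + 1))) (j : Fin r) :
    ∑ k ∈ Finset.Ici j, t k ∈ halfStrip 1 ∧ (t j).re - 1 ≤ (∑ k ∈ Finset.Ici j, t k).re := by
  set δ : ℝ := 1 / ((r : ℝ) + 1) with hδ
  have hδ0 : 0 < δ := by positivity
  have hrδ : (r : ℝ) * δ + δ = 1 := by rw [hδ]; field_simp
  have hcard : ∀ s : Finset (Fin r), (s.card : ℝ) * δ ≤ r * δ := fun s => by
    gcongr
    simpa using Finset.card_le_univ s
  have hre : (t j).re - r * δ ≤ (∑ k ∈ Finset.Ici j, t k).re := by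
    rw [← Finset.add_sum_erase _ _ (Finset.mem_Ici.2 (le_refl j)), add_re, re_sum]
    have := Finset.card_nsmul_le_sum ((Finset.Ici j).erase j) (fun k => (t k).re) (-δ)
      (fun k _ => (ht k).1.le)
    rw [nsmul_eq_mul] at this
    linarith [hcard ((Finset.Ici j).erase j)]
  have him : |(∑ k ∈ Finset.Ici j, t k).im| ≤ r * δ := by
    rw [im_sum]
    refine (Finset.abs_sum_le_sum_abs _ _).trans ?_
    have := Finset.sum_le_card_nsmul (Finset.Ici j) (fun k => |(t k).im|) δ (fun k _ => (ht k).2.le)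
    rw [nsmul_eq_mul] at this
    linarith [hcard (Finset.Ici j)]
  exact ⟨⟨by linarith [(ht j).1], by linarith⟩, by linarith⟩

/-- The j-th factor supplies the decay in t_j, at the cost of e^{1/4} each. The second bound is
uniform in c and serves as the dominating function. -/
theorem exists_norm_limitKernel_le (r : ℕ) :
    ∃ K : ℝ, 0 < K ∧ ∀ t : Fin r → ℂ, (∀ i, t i ∈ halfStrip (1 / ((r : ℝ) + 1))) →
      ‖limitKernel r t‖ ≤ K * ∏ i, Real.exp (-(t i).re / 4) ∧
      ∀ c : ℝ, 1 / 2 ≤ c → c ≤ 2 → c ≠ 1 →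
        ‖kernel r c t / (1 - c) ^ r‖ ≤ K * ∏ i, Real.exp (-(t i).re / 4) := by
  obtain ⟨K, hK, h1, h2⟩ := exists_norm_kernelFactor_div_le
  refine ⟨(K * Real.exp (1 / 4)) ^ r, by positivity, fun t ht => ?_⟩
  have key : ∀ F : ℂ → ℂ, (∀ x ∈ halfStrip 1, ‖F x‖ ≤ K * Real.exp (-x.re / 4)) →
      ‖∏ j : Fin r, F (∑ k ∈ Finset.Ici j, t k)‖ ≤
        (K * Real.exp (1 / 4)) ^ r * ∏ i, Real.exp (-(t i).re / 4) := by
    intro F hF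
    have : (K * Real.exp (1 / 4)) ^ r * ∏ i, Real.exp (-(t i).re / 4) =
        ∏ i : Fin r, (K * Real.exp (1 / 4)) * Real.exp (-(t i).re / 4) := by
      rw [Finset.prod_mul_distrib]; simp
    rw [this, norm_prod]
    refine Finset.prod_le_prod (fun _ _ => norm_nonneg _) fun j _ => ?_
    have hj := sum_Ici_mem_halfStrip ht j
    refine (hF _ hj.1).trans ?_
    rw [mul_assoc, ← Real.exp_add]
    gcongr
    linarith [hj.2]
  refine ⟨key _ h1, fun c hc1 hc2 hc => ?_⟩
  have := key _ (h2 c hc1 hc2 hc)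
  simpa [kernel, Finset.prod_div_distrib] using this

theorem tendsto_kernel_div {r : ℕ} {t : Fin r → ℂ}
    (ht : ∀ i, t i ∈ halfStrip (1 / ((r : ℝ) + 1))) :
    Tendsto (fun c : ℝ => kernel r c t / (1 - c) ^ r) (𝓝[≠] 1) (𝓝 (limitKernel r t)) := by
  have := tendsto_finsetProd (Finset.univ : Finset (Fin r)) fun j _ =>
    tendsto_kernelFactor_div (sum_Ici_mem_halfStrip ht j).1
  simpa [kernel, limitKernel, Finset.prod_div_distrib] using this

theorem differentiableOn_limitKernel_update {r : ℕ} {t : Fin r → ℂ}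
    (ht : ∀ i, t i ∈ halfStrip (1 / ((r : ℝ) + 1))) (k : Fin r) :
    DifferentiableOn ℂ (fun z => limitKernel r (Function.update t k z))
      (halfStrip (1 / ((r : ℝ) + 1))) := by
  refine DifferentiableOn.fun_finsetProd fun j _ => ?_
  refine differentiableOn_limitFactor.comp (f := fun z => ∑ i ∈ Finset.Ici j,
    Function.update t k z i) ?_ fun z hz => ?_
  · refine DifferentiableOn.fun_sum fun i _ => Differentiable.differentiableOn ?_
    exact differentiable_pi.1 (fun z => (hasFDerivAt_update t z).differentiableAt) i
  · refine halfStrip_mono (by norm_num) (sum_Ici_mem_halfStrip (fun i => ?_) j).1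
    by_cases hi : i = k
    · subst hi; simpa using hz
    · simpa [hi] using ht i

/-! ### The limit defining the desingularized zeta function -/

/-- Lebesgue measure on `(0, ∞)^r`. -/
abbrev orthantMeasure (r : ℕ) : Measure (Fin r → ℝ) :=
  Measure.pi fun _ => volume.restrict (Set.Ioi 0)

/-- `∏_k Γ(s_k)^{-1} ∫_{(0,∞)^r} limitKernel(x) ∏_k x_k^{s_k-1} dx_k`. -/
def mellinDes (r : ℕ) (s : Fin r → ℂ) : ℂ :=
  (∏ k, 1 / Complex.Gamma (s k)) *
    ∫ x, limitKernel r (fun k => x k) * ∏ k, realWeight (s k) (x k) ∂(orthantMeasure r)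

theorem hankelIntegral_eq (r : ℕ) (ε : ℝ) (f : (Fin r → ℂ) → ℂ) (s : Fin r → ℂ) :
    hankelIntegral r ε f s = ∫ u, f (fun k => hankelPoint ε (u k)) *
      ∏ k, hankelWeight ε (s k) (u k) ∂(Measure.pi fun _ => volume) := rfl

theorem hankelIntegral_limitKernel {r : ℕ} {s : Fin r → ℂ} (hs : ∀ k, 0 < (s k).re) {ε : ℝ}
    (hε : 0 < ε) (hεr : ε < 1 / ((r : ℝ) + 1)) :
    hankelIntegral r ε (limitKernel r) s =
      (∏ k, (Complex.exp (2 * Real.pi * I * s k) - 1)) *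
        ∫ x, limitKernel r (fun k => x k) * ∏ k, realWeight (s k) (x k) ∂(orthantMeasure r) := by
  obtain ⟨K, hK, hb⟩ := exists_norm_limitKernel_le r
  have hδ0 := hε.trans hεr
  have := integral_pi_contour_change (μ := volume) (ν := volume.restrict (Set.Ioi 0))
    (measurable_hankelPoint ε) measurable_ofReal (D := halfStrip (1 / ((r : ℝ) + 1)))
    ⟨_, hankelPoint_mem_halfStrip hε hεr 0⟩
    (ae_of_all _ (hankelPoint_mem_halfStrip hε hεr))
    ((ae_restrict_mem measurableSet_Ioi).mono fun x hx => ofReal_mem_halfStrip hδ0 hx)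
    (b := fun z => Real.exp (-z.re / 4)) (w := fun k => hankelWeight ε (s k))
    -- The factor from `integral_hankel_eq` is put into the new weight, so that the one-variable
    -- integrals agree exactly.
    (v := fun k x => (Complex.exp (2 * Real.pi * I * s k) - 1) * realWeight (s k) x)
    (fun k => measurable_hankelWeight _ _) (fun k => (measurable_realWeight _).const_mul _)
    (fun k => integrable_hankelWeight (hs k) hε)
    (fun k => by
      simp only [norm_mul, ofReal_re, mul_left_comm (Real.exp _)]
      exact (integrableOn_realWeight (hs k)).const_mul _)
    (measurable_limitKernel r) (fun t ht => (hb t ht).1) (fun k t ht => by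
      have hup : ∀ z ∈ halfStrip (1 / ((r : ℝ) + 1)),
          ∀ i, Function.update t k z i ∈ halfStrip (1 / ((r : ℝ) + 1)) := by
        intro z hz i
        by_cases hi : i = k
        · subst hi; simpa using hz
        · simpa [hi] using ht i
      simp only [mul_left_comm (limitKernel _ _), integral_const_mul]
      -- The decay in the frozen variables is part of the constant.
      refine integral_hankel_eq (K := K * ∏ i ∈ Finset.univ.erase k, Real.exp (-(t i).re / 4))
        hε hεr (differentiableOn_limitKernel_update ht k) (fun z hz => ?_) (hs k)
      refine ((hb _ (hup z hz)).1).trans (le_of_eq ?_)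
      rw [← Finset.prod_erase_mul _ _ (Finset.mem_univ k), Function.update_self, ← mul_assoc]
      congr 2
      refine Finset.prod_congr rfl fun i hi => ?_
      rw [Function.update_of_ne (Finset.ne_of_mem_erase hi)])
  rw [hankelIntegral_eq, this, ← integral_const_mul]
  refine integral_congr_ae (ae_of_all _ fun x => ?_)
  simp only [Finset.prod_mul_distrib]
  ring

/-- The contour stays fixed while c → 1, and only the limit kernel is moved to the real axis.
Non-integrality of s serves to cancel e^{2πi s_k} - 1. -/
theorem isDesZetaLimit_mellinDes {r : ℕ} {s : Fin r → ℂ} (hs : ∀ k, 0 < (s k).re)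
    (hsn : s ∈ nonint r) : IsDesZetaLimit r s (mellinDes r s) := by
  have hδ0 : (0 : ℝ) < 1 / ((r : ℝ) + 1) := by positivity
  filter_upwards [Ioo_mem_nhdsGT hδ0] with ε hε
  obtain ⟨K, hK, hb⟩ := exists_norm_limitKernel_le r
  have hmem : ∀ u : Fin r → ℝ, ∀ i, hankelPoint ε (u i) ∈ halfStrip (1 / ((r : ℝ) + 1)) :=
    fun u i => hankelPoint_mem_halfStrip hε.1 hε.2 _
  have hmP : Measurable fun u : Fin r → ℝ => fun k => hankelPoint ε (u k) :=
    measurable_pi_lambda _ fun k => (measurable_hankelPoint ε).comp (measurable_pi_apply k)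
  have hmW : Measurable fun u : Fin r → ℝ => ∏ k, hankelWeight ε (s k) (u k) :=
    Finset.measurable_prod _ fun k _ => (measurable_hankelWeight ε _).comp (measurable_pi_apply k)
  have hlim : Tendsto (fun c : ℝ => hankelIntegral r ε (fun t => kernel r c t / (1 - c) ^ r) s)
      (𝓝[≠] 1) (𝓝 (hankelIntegral r ε (limitKernel r) s)) := by
    simp only [hankelIntegral_eq]
    refine tendsto_integral_filter_of_dominated_convergence
      (fun u => K * ∏ k, (Real.exp (-(hankelPoint ε (u k)).re / 4) * ‖hankelWeight ε (s k) (u k)‖))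
      ?_ ?_ ?_ ?_
    · exact Eventually.of_forall fun c => ((((measurable_kernel r c).div_const _).comp hmP).mul
        hmW).aestronglyMeasurable
    · have hc : ∀ᶠ c : ℝ in 𝓝[≠] 1, c ∈ Set.Icc (1 / 2 : ℝ) 2 ∧ c ≠ 1 :=
        (eventually_nhdsWithin_of_eventually_nhds (Icc_mem_nhds (by norm_num) (by norm_num))).and
          self_mem_nhdsWithin
      filter_upwards [hc] with c hc
      refine ae_of_all _ fun u => ?_
      rw [norm_mul, norm_prod, Finset.prod_mul_distrib, ← mul_assoc]
      gcongr
      exact (hb _ (hmem u)).2 c hc.1.1 hc.1.2 hc.2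
    · exact (Integrable.fintype_prod (μ := fun _ : Fin r => volume)
        fun k => integrable_hankelWeight (hs k) hε.1).const_mul K
    · exact ae_of_all _ fun u => (tendsto_kernel_div (hmem u)).mul_const _
  rw [hankelIntegral_limitKernel hs hε.1 hε.2] at hlim
  have hval : mellinDes r s = hankelCoeff r s * ((∏ k, (Complex.exp (2 * Real.pi * I * s k) - 1)) *
      ∫ x, limitKernel r (fun k => x k) * ∏ k, realWeight (s k) (x k) ∂(orthantMeasure r)) := by
    rw [mellinDes, hankelCoeff, ← mul_assoc, ← Finset.prod_mul_distrib]
    congr 1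
    refine Finset.prod_congr rfl fun k _ => ?_
    have hne : Complex.exp (2 * Real.pi * I * s k) - 1 ≠ 0 := by
      intro h
      obtain ⟨n, hn⟩ := Complex.exp_eq_one_iff.1 (sub_eq_zero.1 h)
      refine hsn k ⟨n, ?_⟩
      have := Complex.two_pi_I_ne_zero
      rw [mul_comm (n : ℂ)] at hn
      exact (mul_left_cancel₀ this hn).symm
    rw [mul_comm (Complex.exp _ - 1), ← div_div, div_mul_cancel₀ _ hne]
  rw [hval]
  refine (hlim.const_mul _).congr fun c => ?_
  rw [mul_comm (1 / _) (hankelCoeff r s), mul_assoc]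
  congr 1
  rw [hankelIntegral_eq, hankelIntegral_eq, ← integral_const_mul]
  congr 1
  funext u
  ring

/-! ### Holomorphy of the Mellin transform -/

theorem prod_realWeight {r : ℕ} (s : Fin r → ℂ) (x : Fin r → ℝ) :
    ∏ k, realWeight (s k) (x k) = Complex.exp (∑ k, (s k - 1) * Real.log (x k)) := by
  simp only [realWeight, Complex.exp_sum]

theorem integrable_limitKernel_mul {r : ℕ} {s : Fin r → ℂ} (hs : ∀ k, 0 < (s k).re) :
    Integrable (fun x : Fin r → ℝ => limitKernel r (fun k => x k) * ∏ k, realWeight (s k) (x k))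
      (orthantMeasure r) := by
  obtain ⟨K, hK, hb⟩ := exists_norm_limitKernel_le r
  exact integrable_mul_prod_weight measurable_ofReal
    (D := halfStrip (1 / ((r : ℝ) + 1))) (b := fun z => Real.exp (-z.re / 4))
    ((ae_restrict_mem measurableSet_Ioi).mono fun x hx =>
      ofReal_mem_halfStrip (by positivity) hx)
    (fun k => measurable_realWeight (s k)) (fun k => integrableOn_realWeight (hs k))
    (measurable_limitKernel r) (fun t ht => (hb t ht).1)

/-- Differentiation in s brings down logarithms. Since A ≤ δ⁻¹e^{δA}, they cost e^{δ|log x_k|} per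
variable, and moving s by δ costs as much again. Together this is x_k^{2δ} or x_k^{-2δ}, according
to the sign of log x_k. -/
theorem norm_limitKernel_bound {r : ℕ} {K δ : ℝ} (hδ : 0 < δ) (hK : 0 < K)
    (hb : ∀ t : Fin r → ℂ, (∀ i, t i ∈ halfStrip (1 / ((r : ℝ) + 1))) →
      ‖limitKernel r t‖ ≤ K * ∏ i, Real.exp (-(t i).re / 4))
    {s s' : Fin r → ℂ} (hs : ∀ k, |(s' k - s k).re| ≤ δ) {x : Fin r → ℝ} (hx : ∀ k, 0 < x k) :
    ‖limitKernel r (fun k => x k) * ∏ k, realWeight (s' k) (x k)‖ * ∑ k, |Real.log (x k)| ≤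
      K * δ⁻¹ * ∏ k, (Real.exp (-x k / 4) * ‖realWeight (s k + (2 * δ : ℝ)) (x k)‖ +
        Real.exp (-x k / 4) * ‖realWeight (s k - (2 * δ : ℝ)) (x k)‖) := by
  have h1 : ∑ k, |Real.log (x k)| ≤ δ⁻¹ * ∏ k, Real.exp (δ * |Real.log (x k)|) := by
    rw [← Real.exp_sum, ← Finset.mul_sum, ← div_eq_inv_mul, le_div_iff₀' hδ]
    linarith [Real.add_one_le_exp (δ * ∑ k, |Real.log (x k)|)]
  have h2 : ‖limitKernel r (fun k => x k)‖ ≤ K * ∏ k, Real.exp (-x k / 4) := by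
    simpa using hb (fun k => x k) (fun k => ofReal_mem_halfStrip (by positivity) (hx k))
  have h3 : ∀ k, Real.exp (-x k / 4) * ‖realWeight (s' k) (x k)‖ * Real.exp (δ * |Real.log (x k)|) ≤
      Real.exp (-x k / 4) * ‖realWeight (s k + (2 * δ : ℝ)) (x k)‖ +
        Real.exp (-x k / 4) * ‖realWeight (s k - (2 * δ : ℝ)) (x k)‖ := by
    intro k
    rw [← mul_add, mul_assoc]
    gcongr
    have hn : ∀ a : ℂ, ‖realWeight a (x k)‖ = Real.exp ((a.re - 1) * Real.log (x k)) := by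
      intro a; rw [norm_realWeight (hx k), Real.rpow_def_of_pos (hx k), mul_comm]
    rw [hn, hn, hn, ← Real.exp_add]
    have hk := abs_le.1 (hs k)
    simp only [sub_re, add_re, ofReal_re] at hk ⊢
    rcases le_total 0 (Real.log (x k)) with hL | hL
    · refine le_add_of_le_of_nonneg (Real.exp_le_exp.2 ?_) (Real.exp_pos _).le
      rw [abs_of_nonneg hL]; nlinarith
    · refine le_add_of_nonneg_of_le (Real.exp_pos _).le (Real.exp_le_exp.2 ?_)
      rw [abs_of_nonpos hL]; nlinarith
  rw [norm_mul, norm_prod]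
  calc _ ≤ (K * ∏ k, Real.exp (-x k / 4)) * (∏ k, ‖realWeight (s' k) (x k)‖) *
        (δ⁻¹ * ∏ k, Real.exp (δ * |Real.log (x k)|)) := by gcongr
    _ = K * δ⁻¹ * ∏ k, (Real.exp (-x k / 4) * ‖realWeight (s' k) (x k)‖ *
        Real.exp (δ * |Real.log (x k)|)) := by
      rw [Finset.prod_mul_distrib, Finset.prod_mul_distrib]; ring
    _ ≤ _ := by
      gcongr with k _
      exact h3 k

theorem differentiableAt_integral_limitKernel {r : ℕ} {s : Fin r → ℂ} (hs : ∀ k, 0 < (s k).re) :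
    DifferentiableAt ℂ (fun s : Fin r → ℂ => ∫ x, limitKernel r (fun k => x k) *
      ∏ k, realWeight (s k) (x k) ∂(orthantMeasure r)) s := by
  obtain ⟨K, hK, hb⟩ := exists_norm_limitKernel_le r
  -- Keeps Re(s_k - 2δ) > 0, so the dominating product remains integrable at 0.
  obtain ⟨δ, hδ, hδs⟩ : ∃ δ : ℝ, 0 < δ ∧ ∀ k, 2 * δ < (s k).re := by
    have h1 : ∀ᶠ δ : ℝ in 𝓝[>] 0, ∀ k, 2 * δ < (s k).re :=
      eventually_all.2 fun k => by
        filter_upwards [Ioo_mem_nhdsGT (half_pos (hs k))] with δ hδ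
        linarith [hδ.2]
    have h2 : ∀ᶠ δ : ℝ in 𝓝[>] 0, 0 < δ := self_mem_nhdsWithin
    exact (h2.and h1).exists
  have hmG : ∀ s : Fin r → ℂ, Measurable fun x : Fin r → ℝ => limitKernel r (fun k => x k) *
      ∏ k, realWeight (s k) (x k) := fun s =>
    ((measurable_limitKernel r).comp (measurable_pi_lambda _ fun k =>
      measurable_ofReal.comp (measurable_pi_apply k))).mul
      (Finset.measurable_prod _ fun k _ => (measurable_realWeight _).comp (measurable_pi_apply k))
  have hpos : ∀ᵐ x ∂(orthantMeasure r), ∀ k, 0 < x k :=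
    ae_forall_pi (ae_restrict_mem measurableSet_Ioi)
  refine (hasFDerivAt_integral_of_dominated_of_fderiv_le
    (F' := fun s x => (limitKernel r (fun k => x k) * ∏ k, realWeight (s k) (x k)) •
      ∑ k, (Real.log (x k) : ℂ) • (ContinuousLinearMap.proj k : (Fin r → ℂ) →L[ℂ] ℂ))
    (bound := fun x => K * δ⁻¹ * ∏ k, (Real.exp (-x k / 4) *
      ‖realWeight (s k + (2 * δ : ℝ)) (x k)‖ +
        Real.exp (-x k / 4) * ‖realWeight (s k - (2 * δ : ℝ)) (x k)‖))
    (Metric.ball_mem_nhds s hδ) ?_ (integrable_limitKernel_mul hs) ?_ ?_ ?_ ?_).differentiableAt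
  · exact Eventually.of_forall fun s => (hmG s).aestronglyMeasurable
  · refine (hmG s).aestronglyMeasurable.smul (Finset.aestronglyMeasurable_fun_sum _ fun k _ => ?_)
    refine AEStronglyMeasurable.smul_const ?_ _
    exact (measurable_ofReal.comp (Real.measurable_log.comp
      (measurable_pi_apply k))).aestronglyMeasurable
  · filter_upwards [hpos] with x hx s' hs'
    rw [norm_smul]
    refine le_trans ?_ (norm_limitKernel_bound hδ hK (fun t ht => (hb t ht).1) (s' := s')
      (fun k => ?_) hx)
    · gcongr
      refine (norm_sum_le _ _).trans (Finset.sum_le_sum fun k _ => ?_)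
      rw [norm_smul, norm_real, Real.norm_eq_abs]
      refine mul_le_of_le_one_right (abs_nonneg _) ?_
      exact ContinuousLinearMap.opNorm_le_bound _ zero_le_one fun y => by
        simpa using norm_le_pi_norm y k
    · refine (Complex.abs_re_le_norm _).trans ?_
      rw [Metric.mem_ball, dist_eq_norm] at hs'
      exact (norm_le_pi_norm (s' - s) k).trans hs'.le
  · refine (Integrable.fintype_prod (μ := fun _ : Fin r => volume.restrict (Set.Ioi 0))
      (f := fun k (y : ℝ) => Real.exp (-y / 4) * ‖realWeight (s k + (2 * δ : ℝ)) y‖ +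
        Real.exp (-y / 4) * ‖realWeight (s k - (2 * δ : ℝ)) y‖) fun k => ?_).const_mul _
    refine (integrableOn_realWeight ?_).add (integrableOn_realWeight ?_)
    · rw [add_re, ofReal_re]; linarith [hs k]
    · rw [sub_re, ofReal_re]; linarith [hδs k]
  · refine ae_of_all _ fun x s' _ => ?_
    simp only [prod_realWeight]
    have h1 : HasFDerivAt (fun s : Fin r → ℂ => ∑ k, (s k - 1) * (Real.log (x k) : ℂ))
        (∑ k, (Real.log (x k) : ℂ) • (ContinuousLinearMap.proj k : (Fin r → ℂ) →L[ℂ] ℂ)) s' :=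
      HasFDerivAt.fun_sum fun k _ => ((hasFDerivAt_apply k s').sub_const 1).mul_const _
    have h2 := (h1.cexp).const_mul (limitKernel r fun k => x k)
    rwa [smul_smul] at h2

/-- The product of half-planes Re s_k > 0 is the neighbourhood; the prefactor is harmless because
1/Γ is entire. -/
theorem isDesZetaValue_mellinDes {r : ℕ} {s : Fin r → ℂ} (hs : ∀ k, 0 < (s k).re) :
    IsDesZetaValue r s (mellinDes r s) := by
  refine ⟨{s | ∀ k, 0 < (s k).re}, mellinDes r, ?_, hs, fun z hz => ?_, fun z hz =>
    isDesZetaLimit_mellinDes hz.1 hz.2, rfl⟩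
  · simp only [Set.ofPred_forall]
    exact isOpen_iInter_of_finite fun k =>
      isOpen_lt continuous_const (continuous_re.comp (continuous_apply k))
  · refine DifferentiableAt.differentiableWithinAt (DifferentiableAt.mul ?_
      (differentiableAt_integral_limitKernel hz))
    have h1 : ∀ k, DifferentiableAt ℂ (fun s : Fin r → ℂ => 1 / Complex.Gamma (s k)) z := fun k => by
      simp only [one_div]
      exact DifferentiableAt.comp (g := fun w => (Complex.Gamma w)⁻¹) z
        (Complex.differentiable_one_div_Gamma (z k)) (differentiableAt_apply k z)
    exact (HasFDerivAt.finsetProd fun k _ => (h1 k).hasFDerivAt).differentiableAt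

theorem desZeta_eq_mellinDes {r : ℕ} {s : Fin r → ℂ} (hs : ∀ k, 0 < (s k).re) :
    desZeta r s = mellinDes r s := by
  have h : ∃ v, IsDesZetaValue r s v := ⟨_, isDesZetaValue_mellinDes hs⟩
  rw [desZeta, dif_pos h]
  exact h.choose_spec.unique (isDesZetaValue_mellinDes hs)

/-! ### The values at positive integers -/

theorem realWeight_natCast_add_one (k : ℕ) {x : ℝ} (hx : 0 < x) :
    realWeight (k + 1) x = (x : ℂ) ^ k := by
  rw [realWeight, add_sub_cancel_right, Complex.exp_nat_mul, ← ofReal_exp, Real.exp_log hx]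

/-- The integrand `limitFactor(x) x^p`. -/
def singleIntegrand (p : ℕ) (x : ℝ) : ℂ := limitFactor x * (x : ℂ) ^ p

/-- The integrand `limitFactor(x + y) limitFactor(y) x^a y^b`. -/
def doubleIntegrand (a b : ℕ) (z : ℝ × ℝ) : ℂ :=
  limitFactor (z.1 + z.2) * limitFactor z.2 * ((z.1 : ℂ) ^ a * (z.2 : ℂ) ^ b)

theorem limitKernel_one (t : Fin 1 → ℂ) : limitKernel 1 t = limitFactor (t 0) := by
  have : Finset.Ici (0 : Fin 1) = {0} := by decide
  simp [limitKernel, this]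

theorem limitKernel_two (t : Fin 2 → ℂ) :
    limitKernel 2 t = limitFactor (t 0 + t 1) * limitFactor (t 1) := by
  have h0 : Finset.Ici (0 : Fin 2) = {0, 1} := by decide
  have h1 : Finset.Ici (1 : Fin 2) = {1} := by decide
  simp [limitKernel, Fin.prod_univ_two, h0, h1]

theorem integrable_singleIntegrand (p : ℕ) :
    IntegrableOn (singleIntegrand p) (Set.Ioi 0) := by
  obtain ⟨K, hK, hb, -⟩ := exists_norm_kernelFactor_div_le
  have h := integrableOn_mul_realWeight one_pos
    (differentiableOn_limitFactor.mono (halfStrip_mono (by norm_num))) hb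
    (s := (p : ℂ) + 1) (by simp; positivity)
  refine h.congr_fun (fun x hx => ?_) measurableSet_Ioi
  simp only [singleIntegrand, realWeight_natCast_add_one p hx]

theorem mellinDes_one (p : ℕ) :
    mellinDes 1 ![(p : ℂ) + 1] =
      (∫ x in Set.Ioi 0, singleIntegrand p x) / (p.factorial : ℂ) := by
  have h := integral_fintype_prod_eq_prod (𝕜 := ℂ)
    (f := fun (_ : Fin 1) (x : ℝ) => limitFactor x * realWeight (p + 1) x)
    (μ := fun _ => volume.restrict (Set.Ioi 0))
  simp only [Fin.prod_univ_one] at h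
  simp only [mellinDes, limitKernel_one, Fin.prod_univ_one, Matrix.cons_val_zero,
    Complex.Gamma_nat_eq_factorial]
  rw [h, one_div, div_eq_inv_mul]
  congr 1
  refine setIntegral_congr_fun measurableSet_Ioi fun x hx => ?_
  simp only [singleIntegrand, realWeight_natCast_add_one p hx]

theorem ae_pos_prod : ∀ᵐ z ∂((volume.restrict (Set.Ioi (0 : ℝ))).prod
    (volume.restrict (Set.Ioi (0 : ℝ)))), 0 < z.1 ∧ 0 < z.2 :=
  ae_prod_and (ae_restrict_mem measurableSet_Ioi) (ae_restrict_mem measurableSet_Ioi)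

theorem limitKernel_two_mul_realWeight (a b : ℕ) {x y : ℝ} (hx : 0 < x) (hy : 0 < y) :
    limitKernel 2 (fun k => ((![x, y] : Fin 2 → ℝ) k : ℂ)) *
      ∏ k, realWeight ((![(a : ℂ) + 1, (b : ℂ) + 1] : Fin 2 → ℂ) k) ((![x, y] : Fin 2 → ℝ) k) =
      doubleIntegrand a b (x, y) := by
  simp [limitKernel_two, Fin.prod_univ_two, doubleIntegrand, realWeight_natCast_add_one, hx, hy]

theorem integrable_doubleIntegrand (a b : ℕ) :
    Integrable (doubleIntegrand a b) ((volume.restrict (Set.Ioi (0 : ℝ))).prod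
      (volume.restrict (Set.Ioi (0 : ℝ)))) := by
  have h := integrable_limitKernel_mul (s := ![(a : ℂ) + 1, (b : ℂ) + 1]) (by
    intro k; fin_cases k <;> simp <;> positivity)
  have hm := (measurePreserving_piFinTwo (fun _ : Fin 2 => volume.restrict (Set.Ioi (0 : ℝ)))).symm
  have h2 := (hm.integrable_comp_emb (MeasurableEquiv.measurableEmbedding _)).2 h
  refine h2.congr ?_
  filter_upwards [ae_pos_prod] with z hz
  exact limitKernel_two_mul_realWeight a b hz.1 hz.2

theorem mellinDes_two (a b : ℕ) :
    mellinDes 2 ![(a : ℂ) + 1, (b : ℂ) + 1] =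
      (∫ z, doubleIntegrand a b z ∂((volume.restrict (Set.Ioi (0 : ℝ))).prod
        (volume.restrict (Set.Ioi (0 : ℝ))))) / ((a.factorial : ℂ) * b.factorial) := by
  have hm := (measurePreserving_piFinTwo (fun _ : Fin 2 => volume.restrict (Set.Ioi (0 : ℝ)))).symm
  rw [mellinDes, ← hm.integral_comp']
  simp only [Fin.prod_univ_two (f := fun k => 1 / Complex.Gamma _), Matrix.cons_val_zero,
    Matrix.cons_val_one, Complex.Gamma_nat_eq_factorial]
  rw [one_div_mul_one_div, one_div, div_eq_inv_mul]
  congr 1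
  refine integral_congr_ae ?_
  filter_upwards [ae_pos_prod] with z hz
  exact limitKernel_two_mul_realWeight a b hz.1 hz.2

/-- The two φ factors already form the depth-two kernel, so only (x + y)^p is expanded. -/
theorem singleIntegrand_mul (p q : ℕ) (z : ℝ × ℝ) :
    singleIntegrand p (z.2 + z.1) * singleIntegrand q z.2 =
      ∑ i ∈ Finset.range (p + 1), (p.choose i : ℂ) * doubleIntegrand (p - i) (q + i) z := by
  simp only [singleIntegrand, doubleIntegrand]
  push_cast
  rw [add_pow, Finset.mul_sum, Finset.sum_mul, add_comm (z.2 : ℂ)]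
  refine Finset.sum_congr rfl fun i _ => ?_
  rw [pow_add]
  ring

theorem integral_singleIntegrand_shift (p q : ℕ) :
    ∫ y in Set.Ioi (0 : ℝ), (∫ x in Set.Ioi y, singleIntegrand p x) * singleIntegrand q y =
      ∑ i ∈ Finset.range (p + 1), (p.choose i : ℂ) *
        ∫ z, doubleIntegrand (p - i) (q + i) z ∂((volume.restrict (Set.Ioi (0 : ℝ))).prod
          (volume.restrict (Set.Ioi (0 : ℝ)))) := by
  have hI : ∀ i ∈ Finset.range (p + 1), Integrable (fun z => (p.choose i : ℂ) *
      doubleIntegrand (p - i) (q + i) z) ((volume.restrict (Set.Ioi (0 : ℝ))).prod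
          (volume.restrict (Set.Ioi (0 : ℝ)))) :=
    fun i _ => (integrable_doubleIntegrand _ _).const_mul _
  have h1 := integrable_finsetSum _ hI
  simp only [← integral_const_mul]
  rw [← integral_finsetSum _ hI]
  simp only [← singleIntegrand_mul] at h1 ⊢
  rw [integral_prod_symm _ h1]
  refine integral_congr_ae (ae_of_all _ fun y => ?_)
  simp only [integral_mul_const]
  rw [← setIntegral_Ioi_comp_add y 0]
  simp

/-- The quadrant is cut along its diagonal. The diagonal itself falls in the second half, where it
is discarded as a null set by passing from `Ici` to `Ioi`. -/
theorem integral_singleIntegrand_mul (p q : ℕ) :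
    (∫ x in Set.Ioi 0, singleIntegrand p x) * (∫ y in Set.Ioi 0, singleIntegrand q y) =
      (∫ y in Set.Ioi (0 : ℝ), (∫ x in Set.Ioi y, singleIntegrand p x) * singleIntegrand q y) +
        ∫ x in Set.Ioi (0 : ℝ), (∫ y in Set.Ioi x, singleIntegrand q y) * singleIntegrand p x := by
  set μ := volume.restrict (Set.Ioi (0 : ℝ)) with hμ
  set h : ℝ × ℝ → ℂ := fun z => singleIntegrand p z.1 * singleIntegrand q z.2 with hh
  have hint : Integrable h (μ.prod μ) :=
    (integrable_singleIntegrand p).mul_prod (integrable_singleIntegrand q)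
  have hT : MeasurableSet {z : ℝ × ℝ | z.2 < z.1} := measurableSet_lt measurable_snd measurable_fst
  rw [← integral_prod_mul, ← integral_add_compl hT hint, ← integral_indicator hT,
    ← integral_indicator hT.compl, integral_prod_symm _ (hint.indicator hT),
    integral_prod _ (hint.indicator hT.compl)]
  congr 1
  · refine setIntegral_congr_fun measurableSet_Ioi fun y hy => ?_
    have : ∀ x, Set.indicator {z : ℝ × ℝ | z.2 < z.1} h (x, y) =
        (Set.Ioi y).indicator (fun x => singleIntegrand p x * singleIntegrand q y) x := by
      intro x; simp [Set.indicator, hh]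
    simp only [this]
    rw [hμ, setIntegral_indicator measurableSet_Ioi, Set.Ioi_inter_Ioi, sup_of_le_right (le_of_lt hy),
      integral_mul_const]
  · refine setIntegral_congr_fun measurableSet_Ioi fun x hx => ?_
    have : ∀ y, Set.indicator {z : ℝ × ℝ | z.2 < z.1}ᶜ h (x, y) =
        (Set.Ici x).indicator (fun y => singleIntegrand q y * singleIntegrand p x) y := by
      intro y; simp [Set.indicator, hh, mul_comm]
    have hs : Set.Ioi 0 ∩ Set.Ici x = Set.Ici x :=
      Set.inter_eq_right.2 (Set.Ici_subset_Ioi.2 hx)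
    simp only [this]
    rw [hμ, setIntegral_indicator measurableSet_Ici, hs, integral_Ici_eq_integral_Ioi,
      integral_mul_const]

/-- With l = q + i, the coefficient is C(p,i)(p-i)!(q+i)!/(p! q!) = C(q+i, q). The terms l < q are
zero and are added so that both halves of the quadrant share one range. -/
theorem shift_div_factorial (p q : ℕ) :
    (∫ y in Set.Ioi (0 : ℝ), (∫ x in Set.Ioi y, singleIntegrand p x) * singleIntegrand q y) /
        ((p.factorial : ℂ) * q.factorial) =
      ∑ l ∈ Finset.range (p + q + 1), (l.choose q : ℂ) *
        mellinDes 2 ![((p + q - l : ℕ) : ℂ) + 1, (l : ℂ) + 1] := by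
  have hrange : p + q + 1 = q + (p + 1) := by ring
  rw [integral_singleIntegrand_shift, hrange, Finset.sum_range_add _ q, Finset.sum_div]
  rw [Finset.sum_eq_zero (s := Finset.range q) fun l hl => by
    rw [Nat.choose_eq_zero_of_lt (Finset.mem_range.1 hl)]; simp, zero_add]
  refine Finset.sum_congr rfl fun i hi => ?_
  have hip : i ≤ p := Nat.lt_succ_iff.1 (Finset.mem_range.1 hi)
  have h1 : p + q - (q + i) = p - i := by omega
  rw [mellinDes_two, h1]
  have e1 : (p.choose i : ℂ) * (i.factorial * (p - i).factorial) = p.factorial := by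
    rw [← mul_assoc]; exact_mod_cast Nat.choose_mul_factorial_mul_factorial hip
  have e2 : ((q + i).choose q : ℂ) * (q.factorial * i.factorial) = (q + i).factorial := by
    have := Nat.choose_mul_factorial_mul_factorial (Nat.le_add_right q i)
    rw [Nat.add_sub_cancel_left] at this
    rw [← mul_assoc]; exact_mod_cast this
  have n1 : ∀ k : ℕ, (k.factorial : ℂ) ≠ 0 := fun k => by exact_mod_cast k.factorial_ne_zero
  have n2 : (p.choose i : ℂ) ≠ 0 := by exact_mod_cast (Nat.choose_pos hip).ne'
  have n3 : ((q + i).choose q : ℂ) ≠ 0 := by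
    exact_mod_cast (Nat.choose_pos (Nat.le_add_right q i)).ne'
  rw [← e1, ← e2]
  have := n1 q; have := n1 i; have := n1 (p - i)
  field_simp

theorem mellinDes_one_mul (p q : ℕ) :
    mellinDes 1 ![(p : ℂ) + 1] * mellinDes 1 ![(q : ℂ) + 1] =
      ∑ l ∈ Finset.range (p + q + 1), ((l.choose p : ℂ) + l.choose q) *
        mellinDes 2 ![((p + q - l : ℕ) : ℂ) + 1, (l : ℂ) + 1] := by
  rw [mellinDes_one, mellinDes_one, div_mul_div_comm, integral_singleIntegrand_mul, add_div,
    shift_div_factorial, mul_comm (p.factorial : ℂ), shift_div_factorial, add_comm q p, add_comm,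
    ← Finset.sum_add_distrib]
  simp only [add_mul]

end DesMZF

end

theorem mainTheorem6 (n m : ℕ) (hn : 0 < n) (hm : 0 < m) :
    (∃ v, DesMZF.IsDesZetaValue 1 ![(n : ℂ)] v) ∧
    (∃ v, DesMZF.IsDesZetaValue 1 ![(m : ℂ)] v) ∧
    (∀ j ∈ Finset.Icc 1 (n + m - 1),
      ∃ v, DesMZF.IsDesZetaValue 2 ![(n : ℂ) + (m : ℂ) - (j : ℂ), (j : ℂ)] v) ∧
    DesMZF.desZeta 1 ![(n : ℂ)] * DesMZF.desZeta 1 ![(m : ℂ)] =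
      ∑ j ∈ Finset.Icc 1 (n + m - 1),
        (((j - 1).choose (n - 1) : ℂ) + ((j - 1).choose (m - 1) : ℂ)) *
          DesMZF.desZeta 2 ![(n : ℂ) + (m : ℂ) - (j : ℂ), (j : ℂ)] := by
  have h1 : ∀ k : ℕ, 0 < k → ∀ i, 0 < ((![(k : ℂ)] : Fin 1 → ℂ) i).re := by
    intro k hk i
    simpa using hk
  have h2 : ∀ j ∈ Finset.Icc 1 (n + m - 1),
      ∀ i, 0 < ((![(n : ℂ) + (m : ℂ) - (j : ℂ), (j : ℂ)] : Fin 2 → ℂ) i).re := by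
    intro j hj i
    rw [Finset.mem_Icc] at hj
    have hj1 : (1 : ℝ) ≤ j := by exact_mod_cast hj.1
    have hj2 : (j : ℝ) + 1 ≤ n + m := by exact_mod_cast (by omega : j + 1 ≤ n + m)
    fin_cases i
    · simp; linarith
    · simp; linarith
  refine ⟨⟨_, DesMZF.isDesZetaValue_mellinDes (h1 n hn)⟩,
    ⟨_, DesMZF.isDesZetaValue_mellinDes (h1 m hm)⟩,
    fun j hj => ⟨_, DesMZF.isDesZetaValue_mellinDes (h2 j hj)⟩, ?_⟩
  rw [DesMZF.desZeta_eq_mellinDes (h1 n hn), DesMZF.desZeta_eq_mellinDes (h1 m hm),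
    Finset.sum_congr rfl fun j hj => by rw [DesMZF.desZeta_eq_mellinDes (h2 j hj)]]
  -- The substitution n = p + 1, m = q + 1, j = l + 1 turns arguments of ζ^des into exponents of the
  -- integrands.
  obtain ⟨p, rfl⟩ := Nat.exists_eq_succ_of_ne_zero hn.ne'
  obtain ⟨q, rfl⟩ := Nat.exists_eq_succ_of_ne_zero hm.ne'
  have hIcc : Finset.Icc 1 (p.succ + q.succ - 1) = Finset.Ico (0 + 1) (p + q + 1 + 1) := by
    ext j; simp only [Finset.mem_Icc, Finset.mem_Ico]; omega
  rw [hIcc, ← Finset.sum_Ico_add', ← Finset.range_eq_Ico]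
  have := DesMZF.mellinDes_one_mul p q
  push_cast at this ⊢
  rw [this]
  refine Finset.sum_congr rfl fun l hl => ?_
  have hl' : l ≤ p + q := Nat.lt_succ_iff.1 (Finset.mem_range.1 hl)
  have e : ((p + q - l : ℕ) : ℂ) + 1 = (p + 1 : ℂ) + (q + 1) - (l + 1) := by
    rw [Nat.cast_sub hl']; push_cast; ring
  simp [← e]
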